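/- \textbf{Model.} Vehicles on a single-lane road $\mathbb{R}$ form a homogeneous Poisson point process of intensity $\lambda_v>0$; each vehicle is independently V2V-capable with probability $\gamma\in(0,1]$ (otherwise it is a legacy vehicle). Road side units (RSUs) form a grid of spacing $\lambda_r^{-1}$, $\lambda_r>0$, in a uniformly random position independent of the vehicles; each has capacity $\rho^{RSU}>0$. The communication range $d$ satisfies $0<d<\lambda_r^{-1}/2$. Two capable vehicles are linked if their distance is at most $d$ and no other vehicle lies strictly between them; clusters are the connected components of this graph of capable vehicles. In the V2I network a capable vehicle may draw capacity from the RSUs within distance $d$; in the V2V+V2I network it may draw capacity from every RSU within distance $d$ of some vehicle of its cluster. Vehicle rates are the max-min fair allocation: among the rate vectors obtained by splitting each RSU's capacity among the vehicles that may draw on it, one in which the rate of a vehicle can be increased only by decreasing the rate of another vehicle whose rate is no larger. Let $R_v$ and $R_v^*$ be the rates of a typical (Palm) capable vehicle in the V2V+V2I and V2I networks, and let $N$ and $M$ be the numbers of vehicles in, and of RSUs within distance $d$ of some vehicle of, a typical (Palm) cluster. \textbf{Theorem (Expected shared rate).} In both networks the max-min fair rate vector almost surely exists and is unique, and its entries are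 random variables; moreover $0<\mathbb{E}[N]<\infty$, $\mathbb{E}[M]<\infty$, and $$\mathbb{E}[R_v]=\mathbb{E}[R_v^*]=\frac{\rho^{RSU}}{\gamma\lambda_v\lambda_r^{-1}}\left(1-e^{-2\gamma\lambda_v d}\right)\le \rho^{RSU}\,\frac{\mathbb{E}[M]}{\mathbb{E}[N]}.$$ -/

import Mathlib

open MeasureTheory ProbabilityTheory
open scoped ENNReal

/-- A snapshot of a single-lane highway: the positions of all vehicles, which of them are
V2V-capable (the others are legacy vehicles), and the positions of the road side units (RSUs). -/
structure Snapshot where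
  pos : ℤ → ℝ
  cap : ℤ → Bool
  rsu : ℤ → ℝ

namespace Snapshot

/-- V2V links: two distinct capable vehicles at distance at most `d`, with no other vehicle
(capable or legacy) strictly between them, i.e. with an unobstructed line of sight. -/
def v2vGraph (s : Snapshot) (d : ℝ) : SimpleGraph ℤ where
  Adj i j := i ≠ j ∧ s.cap i = true ∧ s.cap j = true ∧ |s.pos i - s.pos j| ≤ d ∧
    ∀ k, ¬ (min (s.pos i) (s.pos j) < s.pos k ∧ s.pos k < max (s.pos i) (s.pos j))
  symm := ⟨fun i j h => ⟨h.1.symm, h.2.2.1, h.2.1, by rw [abs_sub_comm]; exact h.2.2.2.1,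
    fun k => by rw [min_comm, max_comm]; exact h.2.2.2.2 k⟩⟩
  loopless := ⟨fun _ h => h.1 rfl⟩

/-- The V2V relay cluster of vehicle `i`: the vehicles it can reach through V2V links. -/
def cluster (s : Snapshot) (d : ℝ) (i : ℤ) : Set ℤ :=
  {j | (s.v2vGraph d).Reachable i j}

/-- In the V2I network a capable vehicle is connected to the RSUs within range `d`. -/
def reachV2I (s : Snapshot) (d : ℝ) (i k : ℤ) : Prop :=
  s.cap i = true ∧ |s.pos i - s.rsu k| ≤ d

/-- In the V2V+V2I network a capable vehicle is connected to every RSU within range of some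
vehicle of its cluster. -/
def reachV2V (s : Snapshot) (d : ℝ) (i k : ℤ) : Prop :=
  ∃ j ∈ s.cluster d i, s.reachV2I d j k

/-- Number of vehicles in the cluster of `i`. -/
noncomputable def clusterSize (s : Snapshot) (d : ℝ) (i : ℤ) : ℝ≥0∞ :=
  ((s.cluster d i).encard : ℝ≥0∞)

/-- Number of RSUs to which the cluster of `i` is connected. -/
noncomputable def clusterRSUs (s : Snapshot) (d : ℝ) (i : ℤ) : ℝ≥0∞ :=
  (({k | s.reachV2V d i k} : Set ℤ).encard : ℝ≥0∞)

/-- `i` is the rearmost vehicle of a cluster; each finite cluster has exactly one. -/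
def IsClusterHead (s : Snapshot) (d : ℝ) (i : ℤ) : Prop :=
  s.cap i = true ∧ ∀ j ∈ s.cluster d i, s.pos i ≤ s.pos j

end Snapshot

/-- `R` is a feasible vector of vehicle rates when vehicle `i` may draw on RSU `k` exactly if
`reach i k` and each RSU has capacity `ρ`: it arises from nonnegative amounts `a i k` that
RSU `k` gives to vehicle `i`. -/
def IsFeasible (reach : ℤ → ℤ → Prop) (ρ : ℝ≥0∞) (R : ℤ → ℝ≥0∞) : Prop :=
  ∃ a : ℤ → ℤ → ℝ≥0∞, (∀ i k, ¬ reach i k → a i k = 0) ∧ (∀ k, ∑' i, a i k ≤ ρ) ∧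
    ∀ i, R i = ∑' k, a i k

/-- Max-min fairness: the rate of a vehicle can be increased only by decreasing the rate of
a vehicle whose rate is no larger. -/
def IsMaxMinFair (reach : ℤ → ℤ → Prop) (ρ : ℝ≥0∞) (R : ℤ → ℝ≥0∞) : Prop :=
  IsFeasible reach ρ R ∧ ∀ R', IsFeasible reach ρ R' → ∀ i, R i < R' i →
    ∃ j, R' j < R j ∧ R j ≤ R i

open Classical in
/-- The max-min fair rate vector (`0` by convention if there is none). -/
noncomputable def maxMinRate (reach : ℤ → ℤ → Prop) (ρ : ℝ≥0∞) : ℤ → ℝ≥0∞ :=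
  if h : ∃ R, IsMaxMinFair reach ρ R then h.choose else 0

/-- `x` enumerates, in increasing order, a homogeneous Poisson point process on the line of
intensity `lam`: counts in disjoint bounded Borel sets are independent and Poisson. -/
structure IsPoissonProcess {Ω : Type*} [MeasurableSpace Ω] (P : Measure Ω) (lam : ℝ)
    (x : Ω → ℤ → ℝ) : Prop where
  measurable : ∀ i, Measurable fun ω => x ω i
  strictMono : ∀ ω, StrictMono (x ω)
  origin : ∀ ω, x ω 0 ≤ 0 ∧ 0 < x ω 1
  locallyFinite : ∀ ω a b, {i | x ω i ∈ Set.Icc a b}.Finite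
  count : ∀ B : Set ℝ, MeasurableSet B → Bornology.IsBounded B →
    HasLaw (fun ω => {i | x ω i ∈ B}.ncard) (poissonMeasure (lam * volume.real B).toNNReal) P
  indep : ∀ (n : ℕ) (B : Fin n → Set ℝ), (∀ j, MeasurableSet (B j)) →
    (∀ j, Bornology.IsBounded (B j)) → Pairwise (Function.onFun Disjoint B) →
    iIndepFun (fun j ω => {i | x ω i ∈ B j}.ncard) P

/-- The random highway: vehicles form a Poisson process of intensity `lamV`, each of them is
independently V2V-capable with probability `γ`, and the RSUs form a grid of spacing `1 / lamR`
in uniformly random position relative to the vehicles. -/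
structure IsHighway {Ω : Type*} [MeasurableSpace Ω] (P : Measure Ω) (lamV γ lamR : ℝ)
    (S : Ω → Snapshot) : Prop where
  poisson : IsPoissonProcess P lamV fun ω => (S ω).pos
  cap_measurable : ∀ i, Measurable fun ω => (S ω).cap i
  cap_prob : ∀ i, P {ω | (S ω).cap i = true} = ENNReal.ofReal γ
  cap_indep : iIndepFun (fun i ω => (S ω).cap i) P
  cap_indep_pos : IndepFun (fun ω => (S ω).pos) (fun ω => (S ω).cap) P
  rsu_grid : ∀ ω k, (S ω).rsu k = (S ω).rsu 0 + k * lamR⁻¹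
  rsu_measurable : Measurable fun ω => (S ω).rsu 0
  rsu_uniform : HasLaw (fun ω => (S ω).rsu 0) (volume[|Set.Ico 0 lamR⁻¹]) P
  rsu_indep : IndepFun (fun ω => ((S ω).pos, (S ω).cap)) (fun ω => (S ω).rsu 0) P

open Classical in
/-- The expected sum of `f` over the selected vehicles located in the unit window `[0, 1)`. -/
noncomputable def windowSum {Ω : Type*} [MeasurableSpace Ω] (P : Measure Ω) (S : Ω → Snapshot)
    (sel : Snapshot → ℤ → Prop) (f : Snapshot → ℤ → ℝ≥0∞) : ℝ≥0∞ :=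
  ∫⁻ ω, ∑' i, (if sel (S ω) i ∧ (S ω).pos i ∈ Set.Ico (0 : ℝ) 1 then f (S ω) i else 0) ∂P

/-- Palm expectation: the mean of `f` at a typical selected vehicle, i.e. the mean sum of `f`
over the selected vehicles per unit length divided by their mean number per unit length. -/
noncomputable def palmMean {Ω : Type*} [MeasurableSpace Ω] (P : Measure Ω) (S : Ω → Snapshot)
    (sel : Snapshot → ℤ → Prop) (f : Snapshot → ℤ → ℝ≥0∞) : ℝ≥0∞ :=
  windowSum P S sel f / windowSum P S sel fun _ _ => 1

/-- `E[R_v]`: mean shared rate of a typical capable vehicle in the V2V+V2I network. -/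
noncomputable def meanRateV2V {Ω : Type*} [MeasurableSpace Ω] (P : Measure Ω)
    (S : Ω → Snapshot) (d ρ : ℝ) : ℝ≥0∞ :=
  palmMean P S (fun s i => s.cap i = true)
    fun s i => maxMinRate (s.reachV2V d) (ENNReal.ofReal ρ) i

/-- `E[R_v^*]`: mean shared rate of a typical capable vehicle in the V2I network. -/
noncomputable def meanRateV2I {Ω : Type*} [MeasurableSpace Ω] (P : Measure Ω)
    (S : Ω → Snapshot) (d ρ : ℝ) : ℝ≥0∞ :=
  palmMean P S (fun s i => s.cap i = true)
    fun s i => maxMinRate (s.reachV2I d) (ENNReal.ofReal ρ) i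

/-- `E[N]`: mean number of vehicles in a typical cluster. -/
noncomputable def meanClusterSize {Ω : Type*} [MeasurableSpace Ω] (P : Measure Ω)
    (S : Ω → Snapshot) (d : ℝ) : ℝ≥0∞ :=
  palmMean P S (fun s i => s.IsClusterHead d i) fun s i => s.clusterSize d i

/-- `E[M]`: mean number of RSUs connected to a typical cluster. -/
noncomputable def meanClusterRSUs {Ω : Type*} [MeasurableSpace Ω] (P : Measure Ω)
    (S : Ω → Snapshot) (d : ℝ) : ℝ≥0∞ :=
  palmMean P S (fun s i => s.IsClusterHead d i) fun s i => s.clusterRSUs d i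

/-! Relaying moves capacity between vehicles but creates none. An RSU can be used in either network
exactly when some capable vehicle lies within distance `d` of it, and a max-min fair allocation
spends every usable RSU completely. Hence both networks have the same total rate per unit length:
`ρ` times the density `lamR` of RSUs times the probability that an interval of length `2 * d`
contains a capable vehicle. Dividing by the density `γ * lamV` of capable vehicles gives the
formula.

For the rates to make sense on an infinite road, the network has to break up. Almost surely there
are gaps longer than `2 * d` between vehicles arbitrarily far out on both sides. They cut the
vehicles into finite blocks that no V2V link and no common RSU connects, and each vehicle sees at
most one RSU. On a finite block, minimising the sum of squared totals yields a balanced allocation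
(`exists_balanced_finset`). Balance implies max-min fairness (`IsBalanced.isMaxMinFair`), and a fair
vector is unique (`IsDecomposition.isMaxMinFair_unique`).

Conservation of capacity becomes an identity of means through the mass transport principle
(`IsHighway.mass_transport`): every vehicle divides its rate evenly among the RSUs of its block, and
every usable RSU then receives exactly `ρ` (`IsAccess.tsum_rsuShare_left`). The principle rests on
translation invariance (`IsHighway.measurePreserving_shift`), whose main ingredient is that the
count axioms determine the law of a Poisson process (`IsPoissonProcess.map_eq`).

For the inequality, the rates of a cluster add up to at most `ρ` times its number of RSUs
(`Snapshot.tsum_cluster_le`). A second transport, from vehicles to the heads of their clusters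
(`IsHighway.windowSum_cap_eq_head`), turns this bound into one on Palm means; the density of heads
cancels. -/

/-! ### Max-min fairness and balanced allocations -/

/-- On finitely many users and servers, some full use of the servers is balanced: no server
serves a user while it could serve a user with a smaller total. -/
lemma exists_balanced_finset {ι κ : Type*} (J : Finset ι) (K : Finset κ) (r : ι → κ → Prop)
    {ρ : ℝ} (hρ : 0 ≤ ρ) :
    ∃ a : ι → κ → ℝ, (∀ i k, 0 ≤ a i k) ∧ (∀ i k, a i k ≠ 0 → i ∈ J ∧ k ∈ K ∧ r i k) ∧
      (∀ k ∈ K, (∃ i ∈ J, r i k) → ∑ i ∈ J, a i k = ρ) ∧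
      ∀ i ∈ J, ∀ j ∈ J, ∀ k ∈ K, a i k ≠ 0 → r j k →
        ∑ l ∈ K, a i l ≤ ∑ l ∈ K, a j l := by
  classical
  let C : Set (ι → κ → ℝ) := {a | (∀ i k, 0 ≤ a i k) ∧
    (∀ i k, ¬ (i ∈ J ∧ k ∈ K ∧ r i k) → a i k = 0) ∧
    ∀ k ∈ K, (∃ i ∈ J, r i k) → ∑ i ∈ J, a i k = ρ}
  have hcl : IsClosed C := by
    have h1 : IsClosed {a : ι → κ → ℝ | ∀ i k, 0 ≤ a i k} := by
      simp only [Set.ofPred_forall]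
      exact isClosed_iInter fun i => isClosed_iInter fun k =>
        isClosed_le continuous_const (by fun_prop)
    have h2 : IsClosed {a : ι → κ → ℝ | ∀ i k, ¬ (i ∈ J ∧ k ∈ K ∧ r i k) → a i k = 0} := by
      simp only [Set.ofPred_forall]
      exact isClosed_iInter fun i => isClosed_iInter fun k => isClosed_iInter fun _ =>
        isClosed_eq (by fun_prop) continuous_const
    have h3 : IsClosed {a : ι → κ → ℝ | ∀ k ∈ K, (∃ i ∈ J, r i k) → ∑ i ∈ J, a i k = ρ} := by
      simp only [Set.ofPred_forall]
      exact isClosed_iInter fun k => isClosed_iInter fun _ => isClosed_iInter fun _ =>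
        isClosed_eq (by fun_prop) continuous_const
    exact h1.inter (h2.inter h3)
  have hle : ∀ a ∈ C, ∀ i k, a i k ≤ ρ := by
    rintro a ⟨h0, h1, h2⟩ i k
    by_cases h : i ∈ J ∧ k ∈ K ∧ r i k
    · rw [← h2 k h.2.1 ⟨i, h.1, h.2.2⟩]
      exact Finset.single_le_sum (f := fun i => a i k) (fun j _ => h0 j k) h.1
    · rw [h1 i k h]; exact hρ
  have hcomp : IsCompact C := by
    refine IsCompact.of_isClosed_subset (isCompact_univ_pi fun i => isCompact_univ_pi fun k =>
      isCompact_Icc (a := (0 : ℝ)) (b := ρ)) hcl ?_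
    intro a ha i _ k _
    exact ⟨ha.1 i k, hle a ha i k⟩
  have hne : C.Nonempty := by
    by_cases hJ : Nonempty ι
    · have : ∀ k, ∃ i, (∃ i ∈ J, r i k) → i ∈ J ∧ r i k := by
        intro k
        by_cases h : ∃ i ∈ J, r i k
        · exact ⟨h.choose, fun _ => h.choose_spec⟩
        · exact ⟨hJ.some, fun h' => absurd h' h⟩
      choose f hf using this
      refine ⟨fun i k => if k ∈ K ∧ (∃ i ∈ J, r i k) ∧ i = f k then ρ else 0, ?_, ?_, ?_⟩
      · intro i k; dsimp only; split_ifs <;> simp [hρ]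
      · intro i k h
        dsimp only
        rw [if_neg]
        rintro ⟨h1, h2, rfl⟩
        exact h ⟨(hf k h2).1, h1, (hf k h2).2⟩
      · intro k hk h
        simp only [hk, h, true_and]
        rw [Finset.sum_ite_eq' J (f k)]
        simp [(hf k h).1]
    · exact ⟨fun _ _ => 0, fun i _ => absurd ⟨i⟩ hJ, fun i _ => absurd ⟨i⟩ hJ,
        fun k _ ⟨i, _⟩ => absurd ⟨i⟩ hJ⟩
  -- A minimiser of the sum of squared totals is balanced: otherwise a little capacity moved from a
  -- richer user to a poorer one would lower it.
  obtain ⟨a, haC, hmin⟩ := hcomp.exists_isMinOn hne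
    (f := fun a => ∑ i ∈ J, (∑ k ∈ K, a i k) ^ 2) (by fun_prop)
  have haC' := haC
  obtain ⟨h0, h1, h2⟩ := haC
  refine ⟨a, h0, fun i k h => by_contra fun h' => h (h1 i k h'), h2, ?_⟩
  intro i hi j hj k hk hik hjk
  by_contra! hlt
  have hij : i ≠ j := by rintro rfl; exact lt_irrefl _ hlt
  have hik' : i ∈ J ∧ k ∈ K ∧ r i k := by_contra fun h' => hik (h1 i k h')
  set s : ι → ℝ := fun x => ∑ l ∈ K, a x l with hs
  -- Moving `ε` from `i` to `j` changes the objective by `2 * ε * (s j - s i) + 2 * ε ^ 2`, negative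
  -- once `ε < s i - s j`; the bound `ε ≤ a i k` keeps the allocation nonnegative.
  obtain ⟨ε, hε0, hε1, hε2⟩ : ∃ ε : ℝ, 0 < ε ∧ ε ≤ a i k ∧ ε < s i - s j := by
    refine ⟨min (a i k) ((s i - s j) / 2), lt_min (lt_of_le_of_ne (h0 i k) (Ne.symm hik)) ?_,
      min_le_left _ _, (min_le_right _ _).trans_lt ?_⟩ <;> simp only [hs] <;> linarith
  let δ : ι → ℝ := fun x => (if x = j then ε else 0) - if x = i then ε else 0
  have hδ : ∀ g : ι → ℝ, ∑ x ∈ J, g x * δ x = ε * g j - ε * g i := by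
    intro g
    simp only [δ, mul_sub, Finset.sum_sub_distrib, mul_ite, mul_zero, Finset.sum_ite_eq', hi, hj,
      if_true]
    ring
  have hδj : δ j = ε := by simp [δ, hij.symm]
  have hδi : δ i = -ε := by simp [δ, hij]
  let b : ι → κ → ℝ := fun x y => a x y + if y = k then δ x else 0
  have hbC : b ∈ C := by
    refine ⟨fun x y => ?_, fun x y h => ?_, fun y hy h => ?_⟩
    · have := h0 x y
      by_cases hy : y = k
      · subst hy
        by_cases hxi : x = i
        · subst hxi; simp only [b, if_true, hδi]; linarith
        · simp only [b, δ, if_true, hxi, if_false]; split_ifs <;> linarith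
      · simpa [b, hy] using this
    · have hx := h1 x y h
      by_cases hy : y = k
      · subst hy
        have hxi : x ≠ i := by rintro rfl; exact h hik'
        have hxj : x ≠ j := by rintro rfl; exact h ⟨hj, hk, hjk⟩
        simp [b, δ, hx, hxi, hxj]
      · simp [b, hx, hy]
    · by_cases hyk : y = k
      · subst hyk
        have := hδ fun _ => 1
        simp only [one_mul, mul_one, sub_self] at this
        simp only [b, if_true, Finset.sum_add_distrib, h2 y hy h, this, add_zero]
      · simpa [b, hyk] using h2 y hy h
  have hbs : ∀ x, ∑ l ∈ K, b x l = s x + δ x := by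
    intro x
    simp [b, Finset.sum_add_distrib, hk, hs]
  have := hmin hbC
  simp only [Set.mem_ofPred_eq, hbs] at this
  have e1 : ∑ x ∈ J, (s x + δ x) ^ 2 = ∑ x ∈ J, s x ^ 2 + (2 * ∑ x ∈ J, s x * δ x
      + ∑ x ∈ J, δ x * δ x) := by
    rw [Finset.mul_sum, ← Finset.sum_add_distrib, ← Finset.sum_add_distrib]
    exact Finset.sum_congr rfl fun x _ => by ring
  rw [e1, hδ, hδ, hδj, hδi] at this
  simp only [hs] at this hε2
  nlinarith

/-- The rates that an allocation gives to the vehicles. -/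
noncomputable def rateOf (a : ℤ → ℤ → ℝ≥0∞) (i : ℤ) : ℝ≥0∞ := ∑' k, a i k

/-- A balanced allocation uses every reachable RSU fully, and no RSU serves a vehicle while it
could serve one with a smaller rate. -/
structure IsBalanced (reach : ℤ → ℤ → Prop) (ρ : ℝ≥0∞) (a : ℤ → ℤ → ℝ≥0∞) : Prop where
  support : ∀ i k, ¬ reach i k → a i k = 0
  full : ∀ k, (∃ i, reach i k) → ∑' i, a i k = ρ
  balanced : ∀ i j k, a i k ≠ 0 → reach j k → rateOf a i ≤ rateOf a j

/-- The labelling `c` splits the network into finite parts that share no RSU. -/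
structure IsDecomposition {β : Type*} (reach : ℤ → ℤ → Prop) (c : ℤ → β) : Prop where
  finite_part : ∀ i, {j | c j = c i}.Finite
  finite_reach : ∀ i, {k | reach i k}.Finite
  closed : ∀ i j k, reach i k → reach j k → c i = c j

section Decomposition

variable {β : Type*} {reach : ℤ → ℤ → Prop} {c : ℤ → β} {ρ : ℝ≥0∞}

lemma IsBalanced.isFeasible {a : ℤ → ℤ → ℝ≥0∞} (ha : IsBalanced reach ρ a) :
    IsFeasible reach ρ (rateOf a) := by
  refine ⟨a, ha.support, fun k => ?_, fun i => rfl⟩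
  by_cases h : ∃ i, reach i k
  · exact (ha.full k h).le
  · push Not at h
    simp [ha.support _ k (h _)]

lemma IsFeasible.le_mul {R : ℤ → ℝ≥0∞} (hR : IsFeasible reach ρ R) {i : ℤ}
    (hf : {k | reach i k}.Finite) : R i ≤ hf.toFinset.card * ρ := by
  obtain ⟨a, h0, h1, h2⟩ := hR
  rw [h2, tsum_eq_sum (s := hf.toFinset) fun k hk => h0 i k (by simpa using hk), ← nsmul_eq_mul]
  exact Finset.sum_le_card_nsmul _ _ _ fun k _ => (ENNReal.le_tsum i).trans (h1 k)

lemma IsFeasible.ne_top {R : ℤ → ℝ≥0∞} (hR : IsFeasible reach ρ R) (hρ : ρ ≠ ∞) {i : ℤ}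
    (hf : {k | reach i k}.Finite) : R i ≠ ∞ :=
  ne_top_of_le_ne_top (ENNReal.mul_ne_top (by simp) hρ) (hR.le_mul hf)

/-- Parts share no RSU, so balanced allocations chosen on the finite parts, each vehicle following
that of its own part, form a balanced allocation of the whole network. -/
lemma IsDecomposition.exists_isBalanced (hc : IsDecomposition reach c) (hρ : ρ ≠ ∞) :
    ∃ a, IsBalanced reach ρ a := by
  classical
  have key : ∀ n : β, ∃ a : ℤ → ℤ → ℝ, (∀ i k, 0 ≤ a i k) ∧
      (∀ i k, a i k ≠ 0 → c i = n ∧ reach i k) ∧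
      (∀ i k, c i = n → reach i k → ∑' i, ENNReal.ofReal (a i k) = ρ) ∧
      ∀ i j k, a i k ≠ 0 → reach j k →
        ∑' l, ENNReal.ofReal (a i l) ≤ ∑' l, ENNReal.ofReal (a j l) := by
    intro n
    by_cases hn : ∃ i, c i = n
    swap
    · exact ⟨fun _ _ => 0, by simp, by simp, fun i _ hi => absurd ⟨i, hi⟩ hn, by simp⟩
    obtain ⟨i₀, rfl⟩ := hn
    set J := (hc.finite_part i₀).toFinset
    set K := J.biUnion fun i => (hc.finite_reach i).toFinset
    have hJ : ∀ i, i ∈ J ↔ c i = c i₀ := by simp [J]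
    have hK : ∀ i k, c i = c i₀ → reach i k → k ∈ K := by
      intro i k hi hk
      simp only [K, Finset.mem_biUnion, Set.Finite.mem_toFinset, Set.mem_ofPred_eq]
      exact ⟨i, (hJ i).2 hi, hk⟩
    obtain ⟨a, h0, h1, h2, h3⟩ := exists_balanced_finset J K reach ρ.toReal_nonneg
    have hz : ∀ i l, l ∉ K → ENNReal.ofReal (a i l) = 0 := by
      intro i l hl
      rw [show a i l = 0 from by_contra fun h => hl (h1 i l h).2.1, ENNReal.ofReal_zero]
    have hsum : ∀ i, ∑' l, ENNReal.ofReal (a i l) = ENNReal.ofReal (∑ l ∈ K, a i l) := by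
      intro i
      rw [tsum_eq_sum (s := K) (hz i), ENNReal.ofReal_sum_of_nonneg fun l _ => h0 i l]
    refine ⟨a, h0, fun i k h => ⟨(hJ i).1 (h1 i k h).1, (h1 i k h).2.2⟩, ?_, ?_⟩
    · intro i k hi hik
      rw [tsum_eq_sum (s := J) fun l hl => ?_, ← ENNReal.ofReal_sum_of_nonneg fun l _ => h0 l k,
        h2 k (hK i k hi hik) ⟨i, (hJ i).2 hi, hik⟩, ENNReal.ofReal_toReal hρ]
      rw [show a l k = 0 from by_contra fun h => hl (h1 l k h).1, ENNReal.ofReal_zero]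
    · intro i j k hik hjk
      rw [hsum, hsum]
      have h := h1 i k hik
      exact ENNReal.ofReal_le_ofReal (h3 i h.1 j ((hJ j).2
        ((hc.closed j i k hjk h.2.2).trans ((hJ i).1 h.1))) k h.2.1 hik hjk)
  choose a h0 h1 h2 h3 using key
  refine ⟨fun i k => ENNReal.ofReal (a (c i) i k), fun i k h => ?_, ?_, ?_⟩
  · rw [show a (c i) i k = 0 from by_contra fun h' => h (h1 _ i k h').2, ENNReal.ofReal_zero]
  · rintro k ⟨i, hik⟩
    rw [← h2 (c i) i k rfl hik]
    refine tsum_congr fun j => ?_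
    by_cases hj : c j = c i
    · rw [hj]
    · have e1 : a (c i) j k = 0 := by_contra fun h' => hj (h1 _ j k h').1
      have e2 : a (c j) j k = 0 := by_contra fun h' => hj (hc.closed j i k (h1 _ j k h').2 hik)
      rw [e1, e2]
  · intro i j k hik hjk
    have hik' : a (c i) i k ≠ 0 := fun h => hik (by simp [h])
    have := h3 (c i) i j k hik' hjk
    have hcj : c j = c i := hc.closed j i k hjk (h1 _ i k hik').2
    simpa only [rateOf, hcj] using this

/-- Consider the vehicles in the part of `i` that are no richer than `i`. By balance, any RSU that
one of them can use gives everything to this group, so the group already has the largest possible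
total. If `i` gains, some member of the group must lose. -/
lemma IsBalanced.isMaxMinFair (hc : IsDecomposition reach c) (hρ : ρ ≠ ∞)
    {a : ℤ → ℤ → ℝ≥0∞} (ha : IsBalanced reach ρ a) : IsMaxMinFair reach ρ (rateOf a) := by
  classical
  refine ⟨ha.isFeasible, fun R' hR' i hi => ?_⟩
  by_contra! hcon
  obtain ⟨a', h0', h1', h2'⟩ := hR'
  set L := (hc.finite_part i).toFinset.filter fun j => rateOf a j ≤ rateOf a i with hL
  have hiL : i ∈ L := by simp [hL]
  have hterm : ∀ k, ∑ j ∈ L, a' j k ≤ ∑ j ∈ L, a j k := by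
    intro k
    by_cases h : ∃ j ∈ L, reach j k
    · obtain ⟨j, hj, hjk⟩ := h
      have e : ∑' i, a i k = ∑ j ∈ L, a j k := by
        refine tsum_eq_sum fun l hl => by_contra fun hlk => hl ?_
        have hlr : reach l k := by_contra fun h => hlk (ha.support l k h)
        simp only [hL, Finset.mem_filter, Set.Finite.mem_toFinset, Set.mem_ofPred_eq] at hj ⊢
        exact ⟨(hc.closed l j k hlr hjk).trans hj.1, (ha.balanced l j k hlk hjk).trans hj.2⟩
      rw [← e, ha.full k ⟨j, hjk⟩]
      exact (ENNReal.sum_le_tsum L).trans (h1' k)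
    · push Not at h
      rw [Finset.sum_eq_zero fun j hj => h0' j k (h j hj)]
      exact zero_le
  have hsum : ∑ j ∈ L, R' j ≤ ∑ j ∈ L, rateOf a j := by
    simp only [h2', rateOf]
    rw [← Summable.tsum_finsetSum fun _ _ => ENNReal.summable,
      ← Summable.tsum_finsetSum fun _ _ => ENNReal.summable]
    exact ENNReal.tsum_le_tsum hterm
  rw [← Finset.add_sum_erase L _ hiL, ← Finset.add_sum_erase L _ hiL] at hsum
  have hle : ∑ j ∈ L.erase i, rateOf a j ≤ ∑ j ∈ L.erase i, R' j := by
    refine Finset.sum_le_sum fun j hj => ?_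
    have hj' : j ∈ L := Finset.mem_of_mem_erase hj
    by_contra! h
    exact absurd (hcon j h) (not_lt.2 (Finset.mem_filter.1 hj').2)
  have hfin : ∑ j ∈ L.erase i, rateOf a j ≠ ∞ :=
    ENNReal.sum_ne_top.2 fun j _ => ha.isFeasible.ne_top hρ (hc.finite_reach j)
  exact absurd hsum (not_le.2 (ENNReal.add_lt_add_of_lt_of_le hfin hi hle))

/-- Changing the rates in a single part keeps feasibility. Two fair vectors can therefore be
compared within one finite part, where minima exist. -/
lemma IsFeasible.glue (hc : ∀ i j k, reach i k → reach j k → c i = c j) {R R' : ℤ → ℝ≥0∞}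
    (hR : IsFeasible reach ρ R) (hR' : IsFeasible reach ρ R') (n : β) [DecidableEq β] :
    IsFeasible reach ρ fun j => if c j = n then R' j else R j := by
  obtain ⟨a, h0, h1, h2⟩ := hR
  obtain ⟨a', h0', h1', h2'⟩ := hR'
  refine ⟨fun i k => if c i = n then a' i k else a i k, fun i k h => ?_, fun k => ?_,
    fun i => ?_⟩
  · simp [h0 i k h, h0' i k h]
  · by_cases h : ∃ i, reach i k ∧ c i = n
    · obtain ⟨i, hik, hi⟩ := h
      refine le_trans (ENNReal.tsum_le_tsum fun j => ?_) (h1' k)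
      by_cases hj : c j = n
      · simp [hj]
      · dsimp only
        rw [if_neg hj, h0 j k fun hjk => hj ((hc j i k hjk hik).trans hi)]
        exact zero_le
    · refine le_trans (ENNReal.tsum_le_tsum fun j => ?_) (h1 k)
      by_cases hj : c j = n
      · dsimp only
        rw [if_pos hj, h0' j k fun hjk => h ⟨j, hjk, hj⟩]
        exact zero_le
      · simp [hj]
  · dsimp only
    split_ifs
    · exact h2' i
    · exact h2 i

/-- Among the disagreements in one part, take `i` with the least value of `min (R i) (R' i)`. If `R
i < R' i`, fairness of `R` yields `j` in the part with `R' j < R j ≤ R i`, a disagreement with a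
smaller minimum. -/
lemma IsDecomposition.isMaxMinFair_unique (hc : IsDecomposition reach c) {R R' : ℤ → ℝ≥0∞}
    (hR : IsMaxMinFair reach ρ R) (hR' : IsMaxMinFair reach ρ R') : R = R' := by
  classical
  by_contra hne
  obtain ⟨i₀, hi₀⟩ := Function.ne_iff.1 hne
  obtain ⟨i, hi, hmin⟩ := Finset.exists_min_image
    ((hc.finite_part i₀).toFinset.filter fun j => R j ≠ R' j) (fun j => min (R j) (R' j))
    ⟨i₀, by simp [hi₀]⟩
  simp only [Finset.mem_filter, Set.Finite.mem_toFinset, Set.mem_ofPred_eq] at hi hmin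
  have main : ∀ R R' : ℤ → ℝ≥0∞, IsMaxMinFair reach ρ R → IsMaxMinFair reach ρ R' →
      (∀ j, c j = c i₀ ∧ R j ≠ R' j → min (R i) (R' i) ≤ min (R j) (R' j)) →
      ¬ R i < R' i := by
    intro R R' hR hR' hmin hlt
    obtain ⟨j, hj1, hj2⟩ := hR.2 _ (hR.1.glue hc.closed hR'.1 (c i₀)) i (by simpa [hi.1])
    split_ifs at hj1 with hcj
    · have := hmin j ⟨hcj, hj1.ne'⟩
      rw [min_eq_left hlt.le, min_eq_right hj1.le] at this
      exact absurd (this.trans_lt (hj1.trans_le hj2)) (lt_irrefl _)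
    · exact lt_irrefl _ hj1
  rcases lt_or_gt_of_ne hi.2 with h | h
  · exact main R R' hR hR' hmin h
  · refine main R' R hR' hR (fun j hj => ?_) h
    rw [min_comm, min_comm (R' j)]
    exact hmin j ⟨hj.1, hj.2.symm⟩

lemma IsDecomposition.existsUnique (hc : IsDecomposition reach c) (hρ : ρ ≠ ∞) :
    ∃! R, IsMaxMinFair reach ρ R := by
  obtain ⟨a, ha⟩ := hc.exists_isBalanced hρ
  exact ⟨rateOf a, ha.isMaxMinFair hc hρ, fun R hR =>
    hc.isMaxMinFair_unique hR (ha.isMaxMinFair hc hρ)⟩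

lemma isMaxMinFair_maxMinRate (h : ∃ R, IsMaxMinFair reach ρ R) :
    IsMaxMinFair reach ρ (maxMinRate reach ρ) := by
  rw [maxMinRate, dif_pos h]
  exact h.choose_spec

lemma IsDecomposition.maxMinRate_eq (hc : IsDecomposition reach c) {R : ℤ → ℝ≥0∞}
    (hR : IsMaxMinFair reach ρ R) : maxMinRate reach ρ = R :=
  hc.isMaxMinFair_unique (isMaxMinFair_maxMinRate ⟨R, hR⟩) hR

lemma IsDecomposition.restrict (hc : IsDecomposition reach c) (J : Set ℤ) :
    IsDecomposition (fun i k => i ∈ J ∧ reach i k) c where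
  finite_part := hc.finite_part
  finite_reach i := (hc.finite_reach i).subset fun _ hk => hk.2
  closed i j k hi hj := hc.closed i j k hi.2 hj.2

/-- The rates in a part of the network that shares no RSU with the rest depend on that part
only. -/
lemma IsDecomposition.maxMinRate_restrict (hc : IsDecomposition reach c) (hρ : ρ ≠ ∞)
    {J : Set ℤ} (hJ : ∀ i j k, i ∈ J → reach i k → reach j k → j ∈ J) {i : ℤ} (hi : i ∈ J) :
    maxMinRate reach ρ i = maxMinRate (fun i k => i ∈ J ∧ reach i k) ρ i := by
  classical
  obtain ⟨a, ha⟩ := hc.exists_isBalanced hρ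
  have hb : IsBalanced (fun i k => i ∈ J ∧ reach i k) ρ fun i k => if i ∈ J then a i k else 0 := by
    refine ⟨fun i k h => ?_, ?_, ?_⟩
    · by_cases hi : i ∈ J
      · simp only [hi, if_true]
        exact ha.support i k fun h' => h ⟨hi, h'⟩
      · simp [hi]
    · rintro k ⟨i, hi, hik⟩
      rw [← ha.full k ⟨i, hik⟩]
      refine tsum_congr fun j => ?_
      by_cases hj : j ∈ J
      · simp [hj]
      · simp [ha.support j k fun hjk => hj (hJ i j k hi hik hjk)]
    · intro i j k hik hjk
      have hi : i ∈ J := by_contra fun h => hik (by simp [h])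
      simp only [hi, if_true] at hik
      simpa only [rateOf, hi, hjk.1, if_true] using ha.balanced i j k hik hjk.2
  rw [hc.maxMinRate_eq (ha.isMaxMinFair hc hρ),
    (hc.restrict J).maxMinRate_eq (hb.isMaxMinFair (hc.restrict J) hρ)]
  simp [rateOf, hi]

/-- The vehicles of a closed finite part share the full capacity of its RSUs. -/
lemma IsDecomposition.sum_maxMinRate (hc : IsDecomposition reach c) (hρ : ρ ≠ ∞) (i : ℤ) :
    ∑' j, {j | c j = c i}.indicator (maxMinRate reach ρ) j =
      ({k | ∃ j, c j = c i ∧ reach j k} : Set ℤ).encard * ρ := by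
  classical
  obtain ⟨a, ha⟩ := hc.exists_isBalanced hρ
  rw [hc.maxMinRate_eq (ha.isMaxMinFair hc hρ), ← ENNReal.tsum_set_const, tsum_subtype
    {k | ∃ j, c j = c i ∧ reach j k} fun _ => ρ]
  have : ∀ j, {j | c j = c i}.indicator (rateOf a) j =
      ∑' k, if c j = c i then a j k else 0 := by
    intro j
    simp only [Set.indicator_apply, Set.mem_ofPred_eq]
    split_ifs <;> simp [rateOf]
  simp_rw [this]
  rw [ENNReal.tsum_comm]
  refine tsum_congr fun k => ?_
  by_cases h : ∃ j, c j = c i ∧ reach j k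
  · rw [Set.indicator_of_mem (by exact h)]
    obtain ⟨j, hj, hjk⟩ := h
    rw [← ha.full k ⟨j, hjk⟩]
    refine tsum_congr fun l => ?_
    by_cases hl : c l = c i
    · simp [hl]
    · simp [hl, ha.support l k fun hlk => hl ((hc.closed l j k hlk hjk).trans hj)]
  · rw [Set.indicator_of_notMem (by exact h), ENNReal.tsum_eq_zero]
    intro j
    split_ifs with hj
    · exact ha.support j k fun hjk => h ⟨j, hj, hjk⟩
    · rfl

end Decomposition

lemma IsFeasible.relabel {reach : ℤ → ℤ → Prop} {ρ : ℝ≥0∞} {R : ℤ → ℝ≥0∞}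
    (hR : IsFeasible reach ρ R) (e f : ℤ ≃ ℤ) :
    IsFeasible (fun i k => reach (e i) (f k)) ρ fun i => R (e i) := by
  obtain ⟨a, h0, h1, h2⟩ := hR
  refine ⟨fun i k => a (e i) (f k), fun i k h => h0 _ _ h, fun k => ?_, fun i => ?_⟩
  · rw [e.tsum_eq fun i => a i (f k)]
    exact h1 _
  · rw [f.tsum_eq fun k => a (e i) k]
    exact h2 _

lemma IsMaxMinFair.relabel {reach : ℤ → ℤ → Prop} {ρ : ℝ≥0∞} {R : ℤ → ℝ≥0∞}
    (hR : IsMaxMinFair reach ρ R) (e f : ℤ ≃ ℤ) :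
    IsMaxMinFair (fun i k => reach (e i) (f k)) ρ fun i => R (e i) := by
  refine ⟨hR.1.relabel e f, fun R' hR' i hi => ?_⟩
  have h := hR'.relabel e.symm f.symm
  simp only [Equiv.apply_symm_apply] at h
  obtain ⟨j, hj1, hj2⟩ := hR.2 _ h (e i) (by simpa using hi)
  exact ⟨e.symm j, by simpa using hj1, by simpa using hj2⟩

/-- Since `maxMinRate` is a choice, it commutes with relabelling only because uniqueness leaves
nothing to choose. -/
lemma maxMinRate_relabel {reach : ℤ → ℤ → Prop} {ρ : ℝ≥0∞}
    (h : ∃! R, IsMaxMinFair reach ρ R) (e f : ℤ ≃ ℤ) (i : ℤ) :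
    maxMinRate (fun i k => reach (e i) (f k)) ρ i = maxMinRate reach ρ (e i) := by
  have h1 := (isMaxMinFair_maxMinRate h.exists).relabel e f
  have h2 := (isMaxMinFair_maxMinRate ⟨_, h1⟩).relabel e.symm f.symm
  simp only [Equiv.apply_symm_apply] at h2
  have := congrFun (h.unique h2 (isMaxMinFair_maxMinRate h.exists)) (e i)
  simpa using this

/-! ### Blocks of vehicles, clusters and their RSUs -/

namespace Snapshot

/-- Snapshots with arbitrarily late and early gaps longer than `2 * d` between vehicles, and with
RSUs more than `2 * d` apart. -/
structure IsSparse (s : Snapshot) (d : ℝ) : Prop where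
  strictMono : StrictMono s.pos
  gap_right : ∀ i, ∃ j ≥ i, 2 * d < s.pos (j + 1) - s.pos j
  gap_left : ∀ i, ∃ j ≤ i, 2 * d < s.pos (j + 1) - s.pos j
  rsu_apart : ∀ k l, k ≠ l → 2 * d < |s.rsu k - s.rsu l|

/-- No gap longer than `2 * d` separates the vehicles `i` and `j`. -/
def SameBlock (s : Snapshot) (d : ℝ) (i j : ℤ) : Prop :=
  ∀ k, min i j ≤ k → k < max i j → s.pos (k + 1) - s.pos k ≤ 2 * d

variable {s : Snapshot} {d : ℝ} {i j k : ℤ}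

lemma SameBlock.refl (i : ℤ) : s.SameBlock d i i := fun k h1 h2 => by omega

lemma SameBlock.symm (h : s.SameBlock d i j) : s.SameBlock d j i :=
  fun k h1 h2 => h k (by omega) (by omega)

lemma SameBlock.trans (h : s.SameBlock d i j) (h' : s.SameBlock d j k) : s.SameBlock d i k := by
  intro l h1 h2
  by_cases hl : min i j ≤ l ∧ l < max i j
  · exact h l hl.1 hl.2
  · exact h' l (by omega) (by omega)

/-- The partition of the vehicles into blocks. -/
def blockSetoid (s : Snapshot) (d : ℝ) : Setoid ℤ :=
  ⟨s.SameBlock d, SameBlock.refl, SameBlock.symm, SameBlock.trans⟩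

/-- The block of a vehicle. -/
def block (s : Snapshot) (d : ℝ) (i : ℤ) : Quotient (s.blockSetoid d) :=
  Quotient.mk (s.blockSetoid d) i

lemma block_eq_iff : s.block d i = s.block d j ↔ s.SameBlock d i j :=
  Quotient.eq (r := s.blockSetoid d)

/-- The threshold `2 * d` serves two purposes: vehicles that see a common RSU are at most `2 * d`
apart, and linked vehicles are at most `d` apart. Neither relation crosses a block boundary. -/
lemma IsSparse.sameBlock_of_abs_le (hs : s.IsSparse d) (h : |s.pos i - s.pos j| ≤ 2 * d) :
    s.SameBlock d i j := by
  intro k h1 h2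
  have e1 := hs.strictMono.monotone h1
  have e2 := hs.strictMono.monotone (Int.add_one_le_iff.2 h2)
  rw [abs_le] at h
  rcases le_total i j with hij | hij
  · rw [min_eq_left hij] at e1; rw [max_eq_right hij] at e2; linarith
  · rw [min_eq_right hij] at e1; rw [max_eq_left hij] at e2; linarith

lemma IsSparse.sameBlock_of_reachable (hs : s.IsSparse d) (hd : 0 < d)
    (h : (s.v2vGraph d).Reachable i j) : s.SameBlock d i j := by
  obtain ⟨w⟩ := h
  induction w with
  | nil => exact SameBlock.refl _
  | cons h _ ih => exact (hs.sameBlock_of_abs_le (h.2.2.2.1.trans (by linarith))).trans ih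

lemma IsSparse.finite_sameBlock (hs : s.IsSparse d) (i : ℤ) : {j | s.SameBlock d j i}.Finite := by
  obtain ⟨n, hn, hn'⟩ := hs.gap_right i
  obtain ⟨m, hm, hm'⟩ := hs.gap_left (i - 1)
  refine (Set.finite_Icc m n).subset fun j hj => ⟨?_, ?_⟩ <;> by_contra! h
  · exact absurd (hj m (by omega) (by omega)) (not_le.2 hm')
  · exact absurd (hj n (by omega) (by omega)) (not_le.2 hn')

lemma IsSparse.subsingleton_reachV2I (hs : s.IsSparse d) (i : ℤ) :
    {k | s.reachV2I d i k}.Subsingleton := by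
  intro k hk l hl
  by_contra hkl
  have := hs.rsu_apart k l hkl
  have h1 := hk.2
  have h2 := hl.2
  rw [abs_le] at h1 h2
  rw [lt_abs] at this
  rcases this with h | h <;> linarith

/-- Access rules between V2I and sharing within blocks. -/
structure IsAccess (s : Snapshot) (d : ℝ) (reach : ℤ → ℤ → Prop) : Prop where
  of_reachV2I : ∀ i k, s.reachV2I d i k → reach i k
  exists_sameBlock : ∀ i k, reach i k → ∃ j, s.SameBlock d i j ∧ s.reachV2I d j k

lemma isAccess_reachV2I : s.IsAccess d (s.reachV2I d) :=
  ⟨fun _ _ h => h, fun i _ h => ⟨i, SameBlock.refl i, h⟩⟩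

lemma IsSparse.isAccess_reachV2V (hs : s.IsSparse d) (hd : 0 < d) :
    s.IsAccess d (s.reachV2V d) :=
  ⟨fun i _ h => ⟨i, SimpleGraph.Reachable.refl i, h⟩,
    fun _ _ ⟨j, hj, hk⟩ => ⟨j, hs.sameBlock_of_reachable hd hj, hk⟩⟩

lemma IsSparse.sameBlock_of_reachV2I (hs : s.IsSparse d) (hi : s.reachV2I d i k)
    (hj : s.reachV2I d j k) : s.SameBlock d i j := by
  refine hs.sameBlock_of_abs_le ?_
  have h1 := abs_le.1 hi.2
  have h2 := abs_le.1 hj.2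
  rw [abs_le]
  constructor <;> linarith

lemma IsAccess.isDecomposition {reach : ℤ → ℤ → Prop} (hr : s.IsAccess d reach)
    (hs : s.IsSparse d) : IsDecomposition reach (s.block d) where
  finite_part i := by simpa only [block_eq_iff] using hs.finite_sameBlock i
  finite_reach i := by
    refine ((hs.finite_sameBlock i).biUnion fun j _ =>
      (hs.subsingleton_reachV2I j).finite).subset fun k hk => ?_
    obtain ⟨j, hj, hjk⟩ := hr.exists_sameBlock i k hk
    exact Set.mem_biUnion hj.symm hjk
  closed i j k hi hj := by
    obtain ⟨i', hi', hik⟩ := hr.exists_sameBlock i k hi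
    obtain ⟨j', hj', hjk⟩ := hr.exists_sameBlock j k hj
    exact block_eq_iff.2 (hi'.trans ((hs.sameBlock_of_reachV2I hik hjk).trans hj'.symm))

/-- The RSUs within range of some capable vehicle of the block of `i`. -/
def blockRSUs (s : Snapshot) (d : ℝ) (i : ℤ) : Set ℤ :=
  {k | ∃ j, s.SameBlock d i j ∧ s.reachV2I d j k}

lemma IsSparse.finite_blockRSUs (hs : s.IsSparse d) (i : ℤ) : (s.blockRSUs d i).Finite := by
  refine ((hs.finite_sameBlock i).biUnion fun j _ =>
      (hs.subsingleton_reachV2I j).finite).subset fun k hk => ?_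
  obtain ⟨j, hj, hjk⟩ := hk
  exact Set.mem_biUnion hj.symm hjk

lemma blockRSUs_eq (h : s.SameBlock d i j) : s.blockRSUs d i = s.blockRSUs d j := by
  ext k
  exact ⟨fun ⟨l, hl, hk⟩ => ⟨l, h.symm.trans hl, hk⟩, fun ⟨l, hl, hk⟩ => ⟨l, h.trans hl, hk⟩⟩

lemma IsSparse.sameBlock_of_mem_blockRSUs (hs : s.IsSparse d) (hi : k ∈ s.blockRSUs d i)
    (hj : k ∈ s.blockRSUs d j) : s.SameBlock d i j := by
  obtain ⟨i', hi', hik⟩ := hi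
  obtain ⟨j', hj', hjk⟩ := hj
  exact hi'.trans ((hs.sameBlock_of_reachV2I hik hjk).trans hj'.symm)

/-- The right side does not involve `reach`: relaying within a block leaves its set of usable RSUs
unchanged. This is the source of the equality of the two mean rates. -/
lemma IsAccess.sum_block {reach : ℤ → ℤ → Prop} (hr : s.IsAccess d reach)
    (hs : s.IsSparse d) {ρ : ℝ≥0∞} (hρ : ρ ≠ ∞) (i : ℤ) :
    ∑' j, {j | s.SameBlock d j i}.indicator (maxMinRate reach ρ) j =
      (s.blockRSUs d i).encard * ρ := by
  have := (hr.isDecomposition hs).sum_maxMinRate hρ i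
  simp only [block_eq_iff] at this
  rw [this]
  congr 3
  ext k
  constructor
  · rintro ⟨j, hj, hjk⟩
    obtain ⟨l, hl, hlk⟩ := hr.exists_sameBlock j k hjk
    exact ⟨l, hj.symm.trans hl, hlk⟩
  · rintro ⟨j, hj, hjk⟩
    exact ⟨j, hj.symm, hr.of_reachV2I j k hjk⟩

open Classical in
/-- The rate of vehicle `i`, split evenly between the RSUs of its block. -/
noncomputable def rsuShare (s : Snapshot) (d : ℝ) (reach : ℤ → ℤ → Prop) (ρ : ℝ≥0∞)
    (i k : ℤ) : ℝ≥0∞ :=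
  if k ∈ s.blockRSUs d i then maxMinRate reach ρ i / (s.blockRSUs d i).encard else 0

lemma IsAccess.tsum_rsuShare_right {reach : ℤ → ℤ → Prop} (hr : s.IsAccess d reach)
    (hs : s.IsSparse d) {ρ : ℝ≥0∞} (hρ : ρ ≠ ∞) (i : ℤ) :
    ∑' k, s.rsuShare d reach ρ i k = maxMinRate reach ρ i := by
  classical
  have h1 : ∑' k, s.rsuShare d reach ρ i k =
      (s.blockRSUs d i).encard * (maxMinRate reach ρ i / (s.blockRSUs d i).encard) := by
    rw [← ENNReal.tsum_set_const, tsum_subtype (s.blockRSUs d i) fun _ =>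
      maxMinRate reach ρ i / (s.blockRSUs d i).encard]
    exact tsum_congr fun k => by simp only [rsuShare, Set.indicator_apply]
  rw [h1]
  -- Without RSUs there is nothing to split over, but then the total rate of the block vanishes, and
  -- so does the rate of `i`.
  by_cases h0 : s.blockRSUs d i = ∅
  · have h2 := hr.sum_block hs hρ i
    rw [h0] at h2
    simp only [Set.encard_empty, ENat.toENNReal_zero, zero_mul, ENNReal.tsum_eq_zero] at h2
    have h3 := h2 i
    rw [Set.indicator_of_mem (by exact SameBlock.refl i)] at h3
    simp [h0, h3]
  · refine ENNReal.mul_div_cancel ?_ ?_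
    · simpa using h0
    · simpa using hs.finite_blockRSUs i

-- Only the block around RSU `k` contributes. Its total rate is `ρ` times its number of RSUs, and
-- each of these receives an equal share.
open Classical in
lemma IsAccess.tsum_rsuShare_left {reach : ℤ → ℤ → Prop} (hr : s.IsAccess d reach)
    (hs : s.IsSparse d) {ρ : ℝ≥0∞} (hρ : ρ ≠ ∞) (k : ℤ) :
    ∑' i, s.rsuShare d reach ρ i k = if ∃ j, s.reachV2I d j k then ρ else 0 := by
  split_ifs with h
  · obtain ⟨j, hj⟩ := h
    have hkj : k ∈ s.blockRSUs d j := ⟨j, SameBlock.refl j, hj⟩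
    have e : ∀ i, s.rsuShare d reach ρ i k = {i | s.SameBlock d i j}.indicator
        (maxMinRate reach ρ) i * ((s.blockRSUs d j).encard : ℝ≥0∞)⁻¹ := by
      intro i
      by_cases hi : s.SameBlock d i j
      · rw [Set.indicator_of_mem (by exact hi), rsuShare, blockRSUs_eq hi, if_pos hkj,
          div_eq_mul_inv]
      · rw [Set.indicator_of_notMem (by exact hi), rsuShare, if_neg, zero_mul]
        exact fun hk => hi (hs.sameBlock_of_mem_blockRSUs hk hkj)
    simp_rw [e]
    rw [ENNReal.tsum_mul_right, hr.sum_block hs hρ j, mul_comm, ← mul_assoc,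
      ENNReal.inv_mul_cancel, one_mul]
    · simpa using Set.nonempty_iff_ne_empty.1 ⟨k, hkj⟩
    · simpa using hs.finite_blockRSUs j
  · rw [ENNReal.tsum_eq_zero]
    intro i
    rw [rsuShare, if_neg]
    rintro ⟨j, _, hj⟩
    exact h ⟨j, hj⟩

lemma cap_of_reachable (h : (s.v2vGraph d).Reachable i j) (hi : s.cap i = true) :
    s.cap j = true := by
  obtain ⟨w⟩ := h
  induction w with
  | nil => exact hi
  | cons h _ ih => exact ih h.2.2.1

lemma cluster_eq (h : (s.v2vGraph d).Reachable i j) : s.cluster d i = s.cluster d j := by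
  ext l
  exact ⟨fun hl => h.symm.trans hl, fun hl => h.trans hl⟩

-- A cluster lies in a finite block, so it has a rearmost vehicle; distinct vehicles have distinct
-- positions, so it has only one.
open Classical in
lemma IsSparse.tsum_head (hs : s.IsSparse d) (hd : 0 < d) (hi : s.cap i = true) :
    ∑' j, (if s.IsClusterHead d j ∧ (s.v2vGraph d).Reachable i j then (1 : ℝ≥0∞) else 0) = 1 := by
  have hfin : (s.cluster d i).Finite :=
    (hs.finite_sameBlock i).subset fun j hj => (hs.sameBlock_of_reachable hd hj).symm
  obtain ⟨j, hj, hmin⟩ := hfin.exists_minimalFor s.pos _ ⟨i, SimpleGraph.Reachable.refl i⟩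
  have hmin' : ∀ l ∈ s.cluster d i, s.pos j ≤ s.pos l := fun l hl =>
    (le_total (s.pos j) (s.pos l)).elim id fun h => hmin hl h
  rw [tsum_eq_single j, if_pos]
  · refine ⟨⟨cap_of_reachable hj hi, ?_⟩, hj⟩
    rwa [← cluster_eq hj]
  · intro l hl
    rw [if_neg]
    rintro ⟨⟨_, hl1⟩, hl2⟩
    rw [← cluster_eq hl2] at hl1
    exact hl (hs.strictMono.injective (le_antisymm (hl1 j hj) (hmin' l hl2)))

/-- Choosing for each RSU a cluster vehicle that sees it is injective, as a vehicle sees at most one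
RSU. This later makes `meanClusterRSUs` finite. -/
lemma IsSparse.clusterRSUs_le (hs : s.IsSparse d) (i : ℤ) :
    s.clusterRSUs d i ≤ s.clusterSize d i := by
  have : ∀ k, ∃ j, s.reachV2V d i k → j ∈ s.cluster d i ∧ s.reachV2I d j k := by
    intro k
    by_cases h : s.reachV2V d i k
    · obtain ⟨j, hj⟩ := h
      exact ⟨j, fun _ => hj⟩
    · exact ⟨0, fun h' => absurd h' h⟩
  choose f hf using this
  refine ENat.toENNReal_mono (Set.encard_le_encard_of_injOn (f := f) (fun k hk => (hf k hk).1) ?_)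
  intro k hk l hl hkl
  have h1 := (hf k hk).2
  rw [hkl] at h1
  exact hs.subsingleton_reachV2I _ h1 (hf l hl).2

lemma tsum_cluster_le {ρ : ℝ≥0∞} {R : ℤ → ℝ≥0∞} (hR : IsFeasible (s.reachV2V d) ρ R) (j : ℤ) :
    ∑' i, (s.cluster d j).indicator R i ≤ ρ * s.clusterRSUs d j := by
  classical
  obtain ⟨a, h0, h1, h2⟩ := hR
  have e : ∀ i, (s.cluster d j).indicator R i =
      ∑' k, (s.cluster d j).indicator (fun i => a i k) i := by
    intro i
    by_cases hi : i ∈ s.cluster d j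
    · simp [hi, h2]
    · simp [hi]
  simp_rw [e]
  rw [ENNReal.tsum_comm, clusterRSUs, mul_comm, ← ENNReal.tsum_set_const,
    tsum_subtype {k | s.reachV2V d j k} fun _ => ρ]
  refine ENNReal.tsum_le_tsum fun k => ?_
  by_cases hk : s.reachV2V d j k
  · rw [Set.indicator_of_mem (by exact hk)]
    exact (ENNReal.tsum_le_tsum fun i => Set.indicator_le_self _ _ i).trans (h1 k)
  · rw [Set.indicator_of_notMem (by exact hk), nonpos_iff_eq_zero, ENNReal.tsum_eq_zero]
    intro i
    by_cases hi : i ∈ s.cluster d j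
    · rw [Set.indicator_of_mem hi]
      refine h0 i k fun ⟨l, hl, hlk⟩ => hk ⟨l, ?_, hlk⟩
      exact SimpleGraph.Reachable.trans hi hl
    · simp [hi]

/-! ### Equivariance under translation and relabelling -/

/-- `s'` is the snapshot `s` seen from the location `t`, with shifted labels. -/
structure IsRelabel (s s' : Snapshot) (a b : ℤ) (t : ℝ) : Prop where
  pos : ∀ i, s'.pos i = s.pos (i + a) - t
  cap : ∀ i, s'.cap i = s.cap (i + a)
  rsu : ∀ k, s'.rsu k = s.rsu (k + b) - t

namespace IsRelabel

variable {s' : Snapshot} {a b : ℤ} {t : ℝ}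

lemma reachV2I (h : IsRelabel s s' a b t) (i k : ℤ) :
    s'.reachV2I d i k ↔ s.reachV2I d (i + a) (k + b) := by
  simp only [Snapshot.reachV2I, h.pos, h.cap, h.rsu, sub_sub_sub_cancel_right]

lemma adj (h : IsRelabel s s' a b t) (i j : ℤ) :
    (s'.v2vGraph d).Adj i j ↔ (s.v2vGraph d).Adj (i + a) (j + a) := by
  simp only [Snapshot.v2vGraph, h.pos, h.cap, sub_sub_sub_cancel_right, ne_eq,
    add_left_inj]
  rw [(Equiv.addRight a).forall_congr_left (p := fun k => ¬ (_ ∧ _))]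
  simp

lemma reachable (h : IsRelabel s s' a b t) (i j : ℤ) :
    (s'.v2vGraph d).Reachable i j ↔ (s.v2vGraph d).Reachable (i + a) (j + a) := by
  let e : s'.v2vGraph d ≃g s.v2vGraph d := ⟨Equiv.addRight a, fun {i j} => (h.adj i j).symm⟩
  exact (e.reachable_iff (u := i) (v := j)).symm

lemma reachV2V (h : IsRelabel s s' a b t) (i k : ℤ) :
    s'.reachV2V d i k ↔ s.reachV2V d (i + a) (k + b) := by
  simp only [Snapshot.reachV2V, cluster, Set.mem_ofPred_eq, h.reachable, h.reachV2I]
  exact (Equiv.addRight a).exists_congr_left.trans (by simp)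

lemma isClusterHead (h : IsRelabel s s' a b t) (i : ℤ) :
    s'.IsClusterHead d i ↔ s.IsClusterHead d (i + a) := by
  simp only [IsClusterHead, cluster, Set.mem_ofPred_eq, h.reachable, h.cap, h.pos,
    sub_le_sub_iff_right]
  rw [(Equiv.addRight a).forall_congr_left]
  simp

lemma sameBlock (h : IsRelabel s s' a b t) (i j : ℤ) :
    s'.SameBlock d i j ↔ s.SameBlock d (i + a) (j + a) := by
  simp only [SameBlock, h.pos, sub_sub_sub_cancel_right]
  rw [(Equiv.addRight a).forall_congr_left]
  simp only [Equiv.addRight_symm, Equiv.coe_addRight, min_add_add_right, max_add_add_right]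
  refine forall_congr' fun k => ?_
  rw [show k + -a + 1 + a = k + 1 by ring, show k + -a + a = k by ring,
    show min i j ≤ k + -a ↔ min i j + a ≤ k by omega,
    show k + -a < max i j ↔ k < max i j + a by omega]

lemma mem_blockRSUs (h : IsRelabel s s' a b t) (i k : ℤ) :
    k ∈ s'.blockRSUs d i ↔ k + b ∈ s.blockRSUs d (i + a) := by
  simp only [blockRSUs, Set.mem_ofPred_eq, h.sameBlock, h.reachV2I]
  exact (Equiv.addRight a).exists_congr_left.trans (by simp)

lemma encard_blockRSUs (h : IsRelabel s s' a b t) (i : ℤ) :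
    (s'.blockRSUs d i).encard = (s.blockRSUs d (i + a)).encard := by
  have : s.blockRSUs d (i + a) = Equiv.addRight b '' s'.blockRSUs d i := by
    ext k
    rw [Equiv.image_eq_preimage_symm, Set.mem_preimage, h.mem_blockRSUs]
    simp
  rw [this, Function.Injective.encard_image (Equiv.injective _)]

lemma rsuShare (h : IsRelabel s s' a b t) {reach reach' : ℤ → ℤ → Prop} {ρ : ℝ≥0∞}
    (hr : ∀ i k, reach' i k ↔ reach (i + a) (k + b)) (hu : ∃! R, IsMaxMinFair reach ρ R)
    (i k : ℤ) : s'.rsuShare d reach' ρ i k = s.rsuShare d reach ρ (i + a) (k + b) := by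
  have e : reach' = fun i k => reach (Equiv.addRight a i) (Equiv.addRight b k) := by
    ext i k; exact hr i k
  rw [Snapshot.rsuShare, Snapshot.rsuShare, e, h.encard_blockRSUs,
    maxMinRate_relabel hu (Equiv.addRight a) (Equiv.addRight b)]
  classical
  exact if_congr (h.mem_blockRSUs i k) rfl rfl

end IsRelabel

end Snapshot

/-! ### Counting points of a configuration on the line -/

/-- The increasing configurations of points that are unbounded on both sides. -/
def IncreasingConfig : Set (ℤ → ℝ) :=
  {y | StrictMono y ∧ (∀ n : ℕ, ∃ i, (n : ℝ) < y i) ∧ ∀ n : ℕ, ∃ i, y i < -(n : ℝ)}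

lemma strictMono_iff_lt_add_one {y : ℤ → ℝ} : StrictMono y ↔ ∀ i, y i < y (i + 1) :=
  ⟨fun h i => h (by omega), strictMono_int_of_lt_succ⟩

lemma measurableSet_increasingConfig : MeasurableSet IncreasingConfig := by
  have : IncreasingConfig = {y | (∀ i, y i < y (i + 1)) ∧ (∀ n : ℕ, ∃ i, (n : ℝ) < y i) ∧
      ∀ n : ℕ, ∃ i, y i < -(n : ℝ)} := by
    ext y
    simp only [IncreasingConfig, strictMono_iff_lt_add_one]
  rw [this]
  measurability

lemma mem_increasingConfig {y : ℤ → ℝ} (hy : StrictMono y)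
    (hf : ∀ a b, {i | y i ∈ Set.Icc a b}.Finite) : y ∈ IncreasingConfig := by
  refine ⟨hy, fun n => ?_, fun n => ?_⟩
  · by_contra! h
    refine Set.infinite_of_injective_forall_mem (f := fun m : ℕ => (m : ℤ))
      Nat.cast_injective (fun m => ?_) (hf (y 0) n)
    exact ⟨hy.monotone (by positivity), h _⟩
  · by_contra! h
    refine Set.infinite_of_injective_forall_mem (f := fun m : ℕ => -(m : ℤ))
      (fun a b hab => by simpa using hab) (fun m => ?_) (hf (-n) (y 0))
    exact ⟨h _, hy.monotone (by simp)⟩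

lemma exists_lastIndex {y : ℤ → ℝ} (hy : y ∈ IncreasingConfig) (t : ℝ) :
    ∃ n, ∀ i, i ≤ n ↔ y i ≤ t := by
  obtain ⟨hm, hr, hl⟩ := hy
  obtain ⟨a, ha⟩ := exists_nat_gt t
  obtain ⟨b, hb⟩ := exists_nat_gt (-t)
  obtain ⟨i, hi⟩ := hr a
  obtain ⟨j, hj⟩ := hl b
  obtain ⟨n, hn, hmax⟩ := Int.exists_greatest_of_bdd (P := fun i => y i ≤ t)
    ⟨i, fun z hz => (hm.lt_iff_lt.1 (lt_of_le_of_lt hz (ha.trans hi))).le⟩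
    ⟨j, by linarith⟩
  exact ⟨n, fun i => ⟨fun h => (hm.monotone h).trans hn, hmax i⟩⟩

open Classical in
/-- The label of the last point at or before `t`. -/
noncomputable def lastIndex (t : ℝ) (y : ℤ → ℝ) : ℤ :=
  if h : y ∈ IncreasingConfig then (exists_lastIndex h t).choose else 0

lemma le_lastIndex_iff {y : ℤ → ℝ} (hy : y ∈ IncreasingConfig) {t : ℝ} {i : ℤ} :
    i ≤ lastIndex t y ↔ y i ≤ t := by
  rw [lastIndex, dif_pos hy]
  exact (exists_lastIndex hy t).choose_spec i

/-- On increasing configurations, the value is `n` exactly when point `n` is at or before `t` and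
point `n + 1` is not; elsewhere it is the constant `0`. -/
lemma measurable_lastIndex (t : ℝ) : Measurable (lastIndex t) := by
  refine measurable_to_countable' fun n => ?_
  have : lastIndex t ⁻¹' {n} = (IncreasingConfig ∩ {y | y n ≤ t ∧ ¬ y (n + 1) ≤ t}) ∪
      (IncreasingConfigᶜ ∩ {_y | n = 0}) := by
    ext y
    simp only [Set.mem_preimage, Set.mem_singleton_iff, Set.mem_union, Set.mem_inter_iff,
      Set.mem_compl_iff, Set.mem_ofPred_eq]
    by_cases hy : y ∈ IncreasingConfig
    · simp only [hy, true_and, not_true, false_and, or_false, ← le_lastIndex_iff hy]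
      omega
    · simp only [hy, false_and, not_false_iff, true_and, false_or, lastIndex, dite_false]
      exact eq_comm
  rw [this]
  refine (measurableSet_increasingConfig.inter ?_).union
    (measurableSet_increasingConfig.compl.inter (MeasurableSet.const _))
  exact (measurableSet_le (measurable_pi_apply n) measurable_const).inter
    (measurableSet_le (measurable_pi_apply (n + 1)) measurable_const).compl

lemma ncard_Ioc_eq {y : ℤ → ℝ} (hy : y ∈ IncreasingConfig) {a b : ℝ} (hab : a ≤ b) :
    ({i | y i ∈ Set.Ioc a b}.ncard : ℤ) = lastIndex b y - lastIndex a y := by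
  have : {i | y i ∈ Set.Ioc a b} = ↑(Finset.Ioc (lastIndex a y) (lastIndex b y)) := by
    ext i
    rw [Finset.coe_Ioc, Set.mem_Ioc, le_lastIndex_iff hy, ← not_le, le_lastIndex_iff hy, not_le]
    exact Iff.rfl
  rw [this, Set.ncard_coe_finset, Int.card_Ioc, Int.toNat_of_nonneg]
  rw [sub_nonneg, le_lastIndex_iff hy]
  exact ((le_lastIndex_iff hy).1 le_rfl).trans hab

/-- The configuration seen from the location `t`. -/
noncomputable def shiftPos (t : ℝ) (y : ℤ → ℝ) (i : ℤ) : ℝ := y (i + lastIndex t y) - t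

lemma measurable_eval_add {α : Type*} [MeasurableSpace α] (i : ℤ) :
    Measurable fun p : (ℤ → α) × ℤ => p.1 (i + p.2) :=
  measurable_from_prod_countable_left fun n => measurable_pi_apply (i + n)

lemma measurable_shiftPos (t : ℝ) : Measurable (shiftPos t) := by
  refine measurable_pi_iff.2 fun i => ?_
  exact ((measurable_eval_add i).comp (measurable_id.prodMk (measurable_lastIndex t))).sub_const t

/-- The signed partial sums of a two-sided sequence. -/
noncomputable def signedSum (c : ℤ → ℕ) (z : ℤ) : ℤ :=
  ∑ k ∈ Finset.Ico 0 z, (c k : ℤ) - ∑ k ∈ Finset.Ico z 0, (c k : ℤ)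

lemma signedSum_add_one (c : ℤ → ℕ) (z : ℤ) : signedSum c (z + 1) = signedSum c z + c z := by
  rcases le_or_gt 0 z with hz | hz
  · have e : Finset.Ico 0 (z + 1) = insert z (Finset.Ico 0 z) := by
      ext k; simp only [Finset.mem_Ico, Finset.mem_insert]; omega
    rw [signedSum, signedSum, e, Finset.sum_insert (by simp),
      Finset.Ico_eq_empty (a := z + 1) (b := 0) (by omega),
      Finset.Ico_eq_empty (a := z) (b := 0) (by omega)]
    simp [add_comm]
  · have e : Finset.Ico z 0 = insert z (Finset.Ico (z + 1) 0) := by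
      ext k; simp only [Finset.mem_Ico, Finset.mem_insert]; omega
    rw [signedSum, signedSum, e, Finset.sum_insert (by simp),
      Finset.Ico_eq_empty (a := 0) (b := z + 1) (by omega),
      Finset.Ico_eq_empty (a := 0) (b := z) (by omega)]
    simp

lemma eq_signedSum {c : ℤ → ℕ} {f : ℤ → ℤ} (h0 : f 0 = 0) (h : ∀ z, f (z + 1) = f z + c z)
    (z : ℤ) : f z = signedSum c z := by
  induction z using Int.induction_on with
  | zero => simp [h0, signedSum]
  | succ i ih => rw [h, ih, signedSum_add_one]
  | pred i ih =>
    have h1 := h (-(i : ℤ) - 1)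
    have h2 := signedSum_add_one c (-(i : ℤ) - 1)
    rw [sub_add_cancel] at h1 h2
    omega

lemma measurable_signedSum (z : ℤ) : Measurable fun c => signedSum c z := by
  unfold signedSum
  exact (Finset.measurable_sum _ fun k _ =>
    (measurable_of_countable (fun n : ℕ => (n : ℤ))).comp (measurable_pi_apply k)).sub
    (Finset.measurable_sum _ fun k _ =>
    (measurable_of_countable (fun n : ℕ => (n : ℤ))).comp (measurable_pi_apply k))

/-- A number as the infimum of the dyadic numbers above it. -/
lemma iInf_dyadic (r : ℝ) [DecidablePred fun q : ℕ × ℤ => r ≤ q.2 / 2 ^ q.1] :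
    ⨅ q : ℕ × ℤ, (if r ≤ q.2 / 2 ^ q.1 then ((q.2 / 2 ^ q.1 : ℝ) : EReal) else ⊤) = r := by
  refine le_antisymm ?_ (le_iInf fun q => ?_)
  · rw [← EReal.le_of_forall_lt_iff_le]
    intro z hz
    have hz' : 0 < z - r := sub_pos.2 (EReal.coe_lt_coe_iff.1 hz)
    obtain ⟨n, hn⟩ := exists_pow_lt_of_lt_one hz' (one_half_lt_one (α := ℝ))
    have h2 : (0 : ℝ) < 2 ^ n := by positivity
    have h1 : r ≤ ⌈r * 2 ^ n⌉ / 2 ^ n := by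
      rw [le_div_iff₀ h2]; exact Int.le_ceil _
    refine iInf_le_of_le (n, ⌈r * 2 ^ n⌉) ?_
    simp only [h1, if_true]
    refine EReal.coe_le_coe_iff.2 ?_
    rw [div_le_iff₀ h2]
    have h3 := Int.ceil_lt_add_one (r * 2 ^ n)
    have h4 : 1 < (z - r) * 2 ^ n := by
      rw [one_div, inv_pow, inv_lt_iff_one_lt_mul₀ h2] at hn
      exact hn
    nlinarith
  · split_ifs with h
    · exact EReal.coe_le_coe_iff.2 h
    · exact le_top

/-! ### Long gaps in a Poisson process -/

namespace IsPoissonProcess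

variable {Ω : Type*} [MeasurableSpace Ω] {P : Measure Ω} {lam : ℝ} {x : Ω → ℤ → ℝ}

lemma mem_increasingConfig (hx : IsPoissonProcess P lam x) (ω : Ω) : x ω ∈ IncreasingConfig :=
  _root_.mem_increasingConfig (hx.strictMono ω) (hx.locallyFinite ω)

lemma measurable_pos (hx : IsPoissonProcess P lam x) : Measurable x :=
  measurable_pi_iff.2 hx.measurable

lemma finite_of_isBounded (hx : IsPoissonProcess P lam x) (ω : Ω) {B : Set ℝ}
    (hB : Bornology.IsBounded B) : {i | x ω i ∈ B}.Finite := by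
  obtain ⟨a, b, hab⟩ := hB.bddBelow.elim fun a ha => hB.bddAbove.elim fun b hb =>
    (⟨a, b, fun r hr => ⟨ha hr, hb hr⟩⟩ : ∃ a b, B ⊆ Set.Icc a b)
  exact (hx.locallyFinite ω a b).subset fun i hi => hab hi

lemma iIndepFun_count (hx : IsPoissonProcess P lam x) {ι : Type*} {B : ι → Set ℝ}
    (hm : ∀ j, MeasurableSet (B j)) (hb : ∀ j, Bornology.IsBounded (B j))
    (hd : Pairwise (Function.onFun Disjoint B)) :
    iIndepFun (fun j ω => {i | x ω i ∈ B j}.ncard) P := by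
  rw [iIndepFun_iff_finset]
  intro s
  have h := hx.indep s.card (fun j => B (s.equivFin.symm j)) (fun _ => hm _) (fun _ => hb _)
    fun i j hij => hd fun h => hij (s.equivFin.symm.injective (Subtype.ext h))
  have h' := h.precomp s.equivFin.injective
  simp only [Equiv.symm_apply_apply] at h'
  exact h'

/-- Infinitely many members of a sequence of disjoint sets of equal size are empty. -/
lemma ae_frequently_empty [IsProbabilityMeasure P] (hx : IsPoissonProcess P lam x)
    {B : ℕ → Set ℝ} (hm : ∀ j, MeasurableSet (B j)) (hb : ∀ j, Bornology.IsBounded (B j))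
    (hd : Pairwise (Function.onFun Disjoint B)) {v : ℝ} (hv : ∀ j, volume.real (B j) = v) :
    ∀ᵐ ω ∂P, ∀ m, ∃ n ≥ m, ∀ i, x ω i ∉ B n := by
  set f : ℕ → Set Ω := fun n => {ω | ∀ i, x ω i ∉ B n} with hf
  have hfe : ∀ n, f n = (fun ω => {i | x ω i ∈ B n}.ncard) ⁻¹' {0} := by
    intro n
    ext ω
    rw [Set.mem_preimage, Set.mem_singleton_iff,
      Set.ncard_eq_zero (hx.finite_of_isBounded ω (hb n)), Set.eq_empty_iff_forall_notMem]
    rfl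
  have hfm : ∀ n, MeasurableSet (f n) := by
    intro n
    have : f n = ⋂ i, {ω | x ω i ∈ B n}ᶜ := by ext; simp [hf]
    rw [this]
    exact MeasurableSet.iInter fun i => (hx.measurable i (hm n)).compl
  have hind : iIndepSet f P := by
    rw [iIndepSet_iff_meas_biInter hfm]
    intro s
    simp only [hfe]
    exact (hx.iIndepFun_count hm hb hd).measure_inter_preimage_eq_mul s
      fun i _ => measurableSet_singleton 0
  have hp : ∀ n, P (f n) = poissonMeasure (lam * v).toNNReal {0} := by
    intro n
    rw [hfe, ← hv n, ← (hx.count (B n) (hm n) (hb n)).map_eq,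
      Measure.map_apply_of_aemeasurable (hx.count (B n) (hm n) (hb n)).aemeasurable
      (measurableSet_singleton 0)]
  -- Second Borel–Cantelli lemma: the independent events all have the same positive probability, so
  -- these probabilities have infinite sum.
  have h1 := measure_limsup_eq_one hfm hind (by
    simp only [hp]
    refine ENNReal.tsum_const_eq_top_of_ne_zero ?_
    rw [poissonMeasure_singleton]
    simp [Real.exp_pos])
  have h2 : ∀ᵐ ω ∂P, ω ∈ Filter.limsup f Filter.atTop := by
    rw [← prob_compl_eq_zero_iff (MeasurableSet.measurableSet_limsup hfm)] at h1
    exact h1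
  filter_upwards [h2] with ω hω
  rw [Filter.mem_limsup_iff_frequently_mem] at hω
  exact fun m => (Filter.frequently_atTop.1 hω m)

end IsPoissonProcess

/-- The cells of the lattice of spacing `L`. -/
def latticeCell (L : ℝ) (k : ℤ) : Set ℝ := Set.Ioc (k * L) ((k + 1) * L)

lemma measurableSet_latticeCell (L : ℝ) (k : ℤ) : MeasurableSet (latticeCell L k) :=
  measurableSet_Ioc

lemma isBounded_latticeCell (L : ℝ) (k : ℤ) : Bornology.IsBounded (latticeCell L k) :=
  Metric.isBounded_Ioc _ _

lemma pairwise_disjoint_latticeCell (L : ℝ) :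
    Pairwise (Function.onFun Disjoint (latticeCell L)) := by
  intro i j hij
  have := Set.pairwise_disjoint_Ioc_zsmul L hij
  simp only [Function.onFun, zsmul_eq_mul, Int.cast_add, Int.cast_one] at this
  exact this

lemma volume_latticeCell {L : ℝ} (hL : 0 ≤ L) (k : ℤ) : volume.real (latticeCell L k) = L := by
  rw [latticeCell, Real.volume_real_Ioc_of_le (by nlinarith)]
  ring

namespace IsPoissonProcess

variable {Ω : Type*} [MeasurableSpace Ω] {P : Measure Ω} [IsProbabilityMeasure P] {lam : ℝ}
  {x : Ω → ℤ → ℝ}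

lemma ae_frequently_latticeCell_empty (hx : IsPoissonProcess P lam x) {L : ℝ} (hL : 0 ≤ L)
    {z : ℕ → ℤ} (hz : Function.Injective z) :
    ∀ᵐ ω ∂P, ∀ m, ∃ n ≥ m, ∀ i, x ω i ∉ latticeCell L (z n) :=
  hx.ae_frequently_empty (fun _ => measurableSet_latticeCell _ _)
    (fun _ => isBounded_latticeCell _ _)
    (fun _ _ hij => pairwise_disjoint_latticeCell L fun h => hij (hz h))
    fun _ => volume_latticeCell hL _

/-- An empty cell of length `L` beyond `x ω i` lies between two consecutive points, which are
therefore more than `L` apart. -/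
lemma ae_gap_right (hx : IsPoissonProcess P lam x) {L : ℝ} (hL : 0 < L) :
    ∀ᵐ ω ∂P, ∀ i, ∃ j ≥ i, L < x ω (j + 1) - x ω j := by
  filter_upwards [hx.ae_frequently_latticeCell_empty hL.le Nat.cast_injective] with ω hω i
  obtain ⟨m, hm⟩ := exists_nat_ge (x ω i / L)
  obtain ⟨n, hn, hB⟩ := hω m
  have hC := hx.mem_increasingConfig ω
  set j := lastIndex (n * L) (x ω) with hj
  have h1 : x ω j ≤ n * L := (le_lastIndex_iff hC).1 le_rfl
  have h2 : n * L < x ω (j + 1) := by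
    rw [← not_le, ← le_lastIndex_iff hC]; omega
  have h3 : (n + 1) * L < x ω (j + 1) := by
    by_contra! h
    exact hB (j + 1) ⟨by simpa using h2, by simpa using h⟩
  refine ⟨j, (le_lastIndex_iff hC).2 ?_, by linarith⟩
  rw [div_le_iff₀ hL] at hm
  exact hm.trans (mul_le_mul_of_nonneg_right (by exact_mod_cast hn) hL.le)

lemma ae_gap_left (hx : IsPoissonProcess P lam x) {L : ℝ} (hL : 0 < L) :
    ∀ᵐ ω ∂P, ∀ i, ∃ j ≤ i, L < x ω (j + 1) - x ω j := by
  filter_upwards [hx.ae_frequently_latticeCell_empty hL.le (z := fun n => -(n : ℤ) - 1)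
    fun a b hab => by simpa using hab] with ω hω i
  obtain ⟨m, hm⟩ := exists_nat_gt (-x ω i / L)
  obtain ⟨n, hn, hB⟩ := hω m
  have hC := hx.mem_increasingConfig ω
  set j := lastIndex ((-n - 1) * L) (x ω) with hj
  have h1 : x ω j ≤ (-n - 1) * L := (le_lastIndex_iff hC).1 le_rfl
  have h2 : (-n - 1) * L < x ω (j + 1) := by
    rw [← not_le, ← le_lastIndex_iff hC]; omega
  have h3 : -n * L < x ω (j + 1) := by
    by_contra! h
    refine hB (j + 1) ⟨?_, ?_⟩ <;> push_cast <;> linarith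
  refine ⟨j, ?_, by linarith⟩
  rw [← (hx.strictMono ω).le_iff_le]
  rw [div_lt_iff₀ hL] at hm
  have h4 : (m : ℝ) * L ≤ n * L := mul_le_mul_of_nonneg_right (by exact_mod_cast hn) hL.le
  linarith

-- The origin convention places label `0` at or before location `0` and label `1` after it, so
-- labels are recovered from cell counts without an unknown offset.
omit [IsProbabilityMeasure P] in
lemma lastIndex_eq_signedSum (hx : IsPoissonProcess P lam x) (ω : Ω) {L : ℝ} (hL : 0 ≤ L)
    (z : ℤ) : lastIndex (z * L) (x ω) =
      signedSum (fun k => {i | x ω i ∈ latticeCell L k}.ncard) z := by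
  have hC := hx.mem_increasingConfig ω
  refine eq_signedSum (f := fun z : ℤ => lastIndex (z * L) (x ω)) ?_ (fun z => ?_) z
  · have h1 : 0 ≤ lastIndex ((0 : ℤ) * L) (x ω) := by
      rw [le_lastIndex_iff hC]; simpa using (hx.origin ω).1
    have h2 : ¬ 1 ≤ lastIndex ((0 : ℤ) * L) (x ω) := by
      rw [le_lastIndex_iff hC]; simpa using (hx.origin ω).2
    omega
  · have := ncard_Ioc_eq hC (a := z * L) (b := (z + 1) * L) (by nlinarith)
    simp only [latticeCell, Int.cast_add, Int.cast_one]
    omega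

/-! ### The count axioms determine the law -/

/-- The numbers of points up to dyadic locations, counted from the origin. -/
noncomputable def dyadicIndex (y : ℤ → ℝ) (q : ℕ × ℤ) : ℤ := lastIndex (q.2 / 2 ^ q.1) y

end IsPoissonProcess

open IsPoissonProcess

lemma measurable_dyadicIndex : Measurable dyadicIndex :=
  measurable_pi_iff.2 fun _ => measurable_lastIndex _

open Classical in
/-- The configuration with given dyadic counts. -/
noncomputable def ofDyadicIndex (w : ℕ × ℤ → ℤ) (i : ℤ) : ℝ :=
  (⨅ q : ℕ × ℤ, (if i ≤ w q then ((q.2 / 2 ^ q.1 : ℝ) : EReal) else ⊤)).toReal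

lemma measurable_ofDyadicIndex : Measurable ofDyadicIndex := by
  refine measurable_pi_iff.2 fun i => measurable_ereal_toReal.comp (Measurable.iInf fun q => ?_)
  exact Measurable.ite (measurableSet_le measurable_const (measurable_pi_apply q))
    measurable_const measurable_const

/-- Point `i` is at or before a dyadic location exactly when the label counted there is at least
`i`; the infimum of such locations is `y i`. -/
lemma ofDyadicIndex_dyadicIndex {y : ℤ → ℝ} (hy : y ∈ IncreasingConfig) :
    ofDyadicIndex (dyadicIndex y) = y := by
  classical
  ext i
  simp only [ofDyadicIndex, dyadicIndex, le_lastIndex_iff hy]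
  rw [iInf_dyadic, EReal.toReal_coe]

namespace IsPoissonProcess

variable {Ω Ω' : Type*} [MeasurableSpace Ω] [MeasurableSpace Ω'] {P : Measure Ω} {P' : Measure Ω'}
  [IsProbabilityMeasure P] [IsProbabilityMeasure P'] {lam : ℝ} {x : Ω → ℤ → ℝ} {x' : Ω' → ℤ → ℝ}

omit [IsProbabilityMeasure P] in
lemma hasLaw_latticeCounts (hx : IsPoissonProcess P lam x) {L : ℝ} (hL : 0 ≤ L) :
    HasLaw (fun ω k => {i | x ω i ∈ latticeCell L k}.ncard)
      (Measure.infinitePi fun _ : ℤ => poissonMeasure (lam * L).toNNReal) P := by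
  have h1 : ∀ k, HasLaw (fun ω => {i | x ω i ∈ latticeCell L k}.ncard)
      (poissonMeasure (lam * L).toNNReal) P := by
    intro k
    have := hx.count _ (measurableSet_latticeCell L k) (isBounded_latticeCell L k)
    rwa [volume_latticeCell hL] at this
  exact (hx.iIndepFun_count (measurableSet_latticeCell L) (isBounded_latticeCell L)
    (pairwise_disjoint_latticeCell L)).hasLaw_infinitePi h1
      (aemeasurable_pi_iff.2 fun k => (h1 k).aemeasurable)

/-- The joint law of finitely many dyadic counts of a Poisson process. -/
noncomputable def dyadicLaw (lam : ℝ) (I : Finset (ℕ × ℤ)) : Measure (I → ℤ) :=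
  (Measure.infinitePi fun _ : ℤ => poissonMeasure (lam * (2 ^ I.sup Prod.fst)⁻¹).toNNReal).map
    fun c q => signedSum c (q.1.2 * 2 ^ (I.sup Prod.fst - q.1.1))

-- Finitely many dyadic locations lie on one lattice, the finest that occurs among them. Its cell
-- counts are i.i.d. Poisson, and the labels are their signed partial sums.
omit [IsProbabilityMeasure P] in
lemma map_restrict_dyadicIndex (hx : IsPoissonProcess P lam x) (I : Finset (ℕ × ℤ)) :
    (P.map (dyadicIndex ∘ x)).map I.restrict = dyadicLaw lam I := by
  have hL : (0 : ℝ) ≤ (2 ^ I.sup Prod.fst)⁻¹ := by positivity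
  have h := hx.hasLaw_latticeCounts hL
  rw [dyadicLaw, ← h.map_eq, Measure.map_map (by fun_prop)
    (measurable_dyadicIndex.comp hx.measurable_pos), AEMeasurable.map_map_of_aemeasurable
    (measurable_pi_iff.2 fun q => measurable_signedSum _).aemeasurable h.aemeasurable]
  congr 1
  ext ω q
  simp only [Function.comp_apply, Finset.restrict, ← hx.lastIndex_eq_signedSum ω hL, dyadicIndex]
  congr 1
  have hq : q.1.1 ≤ I.sup Prod.fst := Finset.le_sup (f := Prod.fst) q.2
  obtain ⟨k, hk⟩ := Nat.exists_eq_add_of_le hq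
  rw [hk, Nat.add_sub_cancel_left]
  push_cast
  rw [pow_add]
  field_simp

omit [IsProbabilityMeasure P'] in
/-- Two Poisson processes of the same intensity have the same law. -/
lemma map_eq (hx : IsPoissonProcess P lam x) (hx' : IsPoissonProcess P' lam x') :
    P.map x = P'.map x' := by
  have h1 : P.map (dyadicIndex ∘ x) = P'.map (dyadicIndex ∘ x') := by
    have : ∀ I, IsFiniteMeasure (dyadicLaw lam I) := fun I => by
      rw [← hx.map_restrict_dyadicIndex I]; infer_instance
    -- Laws with the same finite-dimensional marginals coincide; the positions are then a measurable
    -- function of the dyadic counts.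
    exact IsProjectiveLimit.unique (α := fun _ => ℤ) (P := dyadicLaw lam)
      hx.map_restrict_dyadicIndex hx'.map_restrict_dyadicIndex
  have e : ofDyadicIndex ∘ dyadicIndex ∘ x = x :=
    funext fun ω => ofDyadicIndex_dyadicIndex (hx.mem_increasingConfig ω)
  have e' : ofDyadicIndex ∘ dyadicIndex ∘ x' = x' :=
    funext fun ω => ofDyadicIndex_dyadicIndex (hx'.mem_increasingConfig ω)
  rw [← e, ← e', ← Measure.map_map measurable_ofDyadicIndex
    (measurable_dyadicIndex.comp hx.measurable_pos), h1, Measure.map_map measurable_ofDyadicIndex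
    (measurable_dyadicIndex.comp hx'.measurable_pos)]

omit [IsProbabilityMeasure P] in
/-- A Poisson process seen from another location is a Poisson process. -/
lemma shift (hx : IsPoissonProcess P lam x) (t : ℝ) :
    IsPoissonProcess P lam fun ω => shiftPos t (x ω) := by
  have hset : ∀ ω B, {i | shiftPos t (x ω) i ∈ B} =
      Equiv.addRight (lastIndex t (x ω)) ⁻¹' {i | x ω i ∈ (fun r => r - t) ⁻¹' B} := by
    intro ω B; rfl
  have hcard : ∀ ω B, {i | shiftPos t (x ω) i ∈ B}.ncard =
      {i | x ω i ∈ (fun r => r - t) ⁻¹' B}.ncard := by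
    intro ω B
    rw [hset, ← Equiv.image_symm_eq_preimage, Set.ncard_image_of_injective _ (Equiv.injective _)]
  have hm : ∀ B : Set ℝ, MeasurableSet B → MeasurableSet ((fun r => r - t) ⁻¹' B) :=
    fun B hB => (measurable_id.sub_const t) hB
  have hb : ∀ B : Set ℝ, Bornology.IsBounded B →
      Bornology.IsBounded ((fun r => r - t) ⁻¹' B) := by
    intro B hB
    have : (fun r => r - t) ⁻¹' B = (fun r => r + t) '' B := by
      ext r
      simp only [Set.mem_preimage, Set.mem_image]
      exact ⟨fun h => ⟨_, h, by ring⟩, fun ⟨u, hu, hur⟩ => by rw [← hur]; simpa using hu⟩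
    rw [this]
    exact (LipschitzWith.id.add (LipschitzWith.const t)).isBounded_image hB
  refine ⟨fun i => ?_, fun ω => ?_, fun ω => ?_, fun ω a b => ?_, fun B hB hBb => ?_,
    fun n B hB hBb hBd => ?_⟩
  · exact (measurable_pi_apply i).comp ((measurable_shiftPos t).comp hx.measurable_pos)
  · intro i j hij
    exact sub_lt_sub_right (hx.strictMono ω (by omega)) t
  · have hC := hx.mem_increasingConfig ω
    have h1 := (le_lastIndex_iff hC (t := t)).1 le_rfl
    have h2 : t < x ω (lastIndex t (x ω) + 1) := by
      rw [← not_le, ← le_lastIndex_iff hC]; omega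
    simp only [shiftPos, zero_add, add_comm (1 : ℤ)]
    constructor <;> linarith
  · rw [hset]
    exact (hx.finite_of_isBounded ω (hb _ (Metric.isBounded_Icc a b))).preimage
      (Equiv.injective _).injOn
  · have := hx.count _ (hm B hB) (hb B hBb)
    simp only [hcard]
    convert this using 3
    simp only [measureReal_def, sub_eq_add_neg, measure_preimage_add_right]
  · simp only [hcard]
    exact hx.indep n _ (fun j => hm _ (hB j)) (fun j => hb _ (hBb j))
      fun i j hij => (hBd hij).preimage _

lemma measurePreserving_shiftPos (hx : IsPoissonProcess P lam x) (t : ℝ) :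
    MeasurePreserving (shiftPos t) (P.map x) (P.map x) := by
  refine ⟨measurable_shiftPos t, ?_⟩
  rw [Measure.map_map (measurable_shiftPos t) hx.measurable_pos]
  exact (hx.shift t).map_eq hx

end IsPoissonProcess

/-! ### Translation invariance of the highway -/

/-- Rotations preserve Lebesgue measure on a fundamental interval. -/
lemma measurePreserving_toIcoMod_sub {T : ℝ} (hT : 0 < T) (t : ℝ) :
    MeasurePreserving (fun u => toIcoMod hT 0 (u - t)) (volume.restrict (Set.Ico 0 T))
      (volume.restrict (Set.Ico 0 T)) := by
  have hmod : Measurable (toIcoMod hT 0) := by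
    have : toIcoMod hT 0 = fun u => Int.fract ((u - 0) / T) * T + 0 := by
      ext u
      rw [toIcoMod_eq_add_fract_mul]
      ring
    rw [this]
    exact (((measurable_id.sub_const 0).div_const T).fract.mul_const T).add_const 0
  have hm : Measurable fun u => toIcoMod hT 0 (u - t) := hmod.comp (measurable_id.sub_const t)
  refine ⟨hm, ?_⟩
  ext A hA
  rw [Measure.map_apply hm hA, restrict_Ico_eq_restrict_Ioc,
    Measure.restrict_apply (hm hA), Measure.restrict_apply hA]
  have hA' : MeasurableSet (toIcoMod hT 0 ⁻¹' A) := hmod hA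
  have h1 : volume ((fun u => toIcoMod hT 0 (u - t)) ⁻¹' A ∩ Set.Ioc 0 T) =
      volume (toIcoMod hT 0 ⁻¹' A ∩ Set.Ioc (-t) (-t + T)) := by
    rw [← measure_preimage_add_right volume (-t) (toIcoMod hT 0 ⁻¹' A ∩ _)]
    congr 1
    ext u
    simp only [Set.mem_inter_iff, Set.mem_preimage, Set.mem_Ioc, sub_eq_add_neg]
    refine and_congr_right fun _ => ?_
    constructor <;> rintro ⟨h1, h2⟩ <;> constructor <;> linarith
  -- The preimage of `A` is `T`-periodic, so it has the same measure in any two fundamental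
  -- intervals.
  have h2 : volume (toIcoMod hT 0 ⁻¹' A ∩ Set.Ioc (-t) (-t + T)) =
      volume (toIcoMod hT 0 ⁻¹' A ∩ Set.Ioc 0 (0 + T)) := by
    refine IsAddFundamentalDomain.measure_set_eq (isAddFundamentalDomain_Ioc hT (-t))
      (isAddFundamentalDomain_Ioc hT 0) hA' ?_
    rintro ⟨_, n, rfl⟩
    ext u
    simp only [Set.mem_preimage]
    change toIcoMod hT 0 (n • T + u) ∈ A ↔ _
    rw [toIcoMod_zsmul_add]
  rw [h1, h2, zero_add]
  have h3 : (toIcoMod hT 0 ⁻¹' A ∩ Set.Ico 0 T) = A ∩ Set.Ico 0 T := by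
    ext u
    simp only [Set.mem_inter_iff, Set.mem_preimage]
    refine and_congr_left fun hu => ?_
    rw [(toIcoMod_eq_self hT).2 (by simpa using hu)]
  rw [← Measure.restrict_apply hA', ← Measure.restrict_apply hA, ← restrict_Ico_eq_restrict_Ioc,
    Measure.restrict_apply hA', Measure.restrict_apply hA, h3]

/-- The data that determine a highway with a periodic grid of RSUs: the positions and
capabilities of the vehicles and the phase of the grid. -/
abbrev HighwayState := ((ℤ → ℝ) × (ℤ → Bool)) × ℝ

/-- The snapshot with given data and grid spacing `T`. -/
def HighwayState.toSnapshot (T : ℝ) (p : HighwayState) : Snapshot :=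
  ⟨p.1.1, p.1.2, fun k => p.2 + k * T⟩

/-- The data of a snapshot. -/
def Snapshot.state (s : Snapshot) : HighwayState := ((s.pos, s.cap), s.rsu 0)

/-- The data of the highway seen from the location `t`. -/
noncomputable def HighwayState.shift {T : ℝ} (hT : 0 < T) (t : ℝ) (p : HighwayState) :
    HighwayState :=
  ((shiftPos t p.1.1, fun i => p.1.2 (i + lastIndex t p.1.1)), toIcoMod hT 0 (p.2 - t))

/-- Reducing the phase modulo `T` keeps the same grid and only renumbers the RSUs, by the number of
periods removed. -/
lemma HighwayState.isRelabel_shift {T : ℝ} (hT : 0 < T) (t : ℝ) (p : HighwayState) :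
    ∃ a b, (p.toSnapshot T).IsRelabel ((p.shift hT t).toSnapshot T) a b t := by
  refine ⟨lastIndex t p.1.1, -toIcoDiv hT 0 (p.2 - t), fun i => rfl, fun i => rfl, fun k => ?_⟩
  simp only [toSnapshot, shift, toIcoMod, zsmul_eq_mul]
  push_cast
  ring

namespace IsHighway

variable {Ω : Type*} [MeasurableSpace Ω] {P : Measure Ω} {lamV γ lamR : ℝ} {S : Ω → Snapshot}

lemma toSnapshot_state (hS : IsHighway P lamV γ lamR S) (ω : Ω) :
    (S ω).state.toSnapshot lamR⁻¹ = S ω := by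
  have h : (fun k : ℤ => (S ω).rsu 0 + k * lamR⁻¹) = (S ω).rsu :=
    funext fun k => (hS.rsu_grid ω k).symm
  simp only [Snapshot.state, HighwayState.toSnapshot, h]

lemma measurable_pos (hS : IsHighway P lamV γ lamR S) : Measurable fun ω => (S ω).pos :=
  hS.poisson.measurable_pos

lemma measurable_cap (hS : IsHighway P lamV γ lamR S) : Measurable fun ω => (S ω).cap :=
  measurable_pi_iff.2 hS.cap_measurable

lemma measurable_state (hS : IsHighway P lamV γ lamR S) : Measurable fun ω => (S ω).state :=
  (hS.measurable_pos.prodMk hS.measurable_cap).prodMk hS.rsu_measurable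

variable [IsProbabilityMeasure P]

lemma map_state (hS : IsHighway P lamV γ lamR S) :
    P.map (fun ω => (S ω).state) = ((P.map fun ω => (S ω).pos).prod
      (P.map fun ω => (S ω).cap)).prod (volume[|Set.Ico 0 lamR⁻¹]) := by
  have h1 := (indepFun_iff_map_prod_eq_prod_map_map
    (hS.measurable_pos.prodMk hS.measurable_cap).aemeasurable
    hS.rsu_measurable.aemeasurable).1 hS.rsu_indep
  rw [(indepFun_iff_map_prod_eq_prod_map_map hS.measurable_pos.aemeasurable
    hS.measurable_cap.aemeasurable).1 hS.cap_indep_pos, hS.rsu_uniform.map_eq] at h1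
  exact h1

lemma map_cap_apply (hS : IsHighway P lamV γ lamR S) (i : ℤ) :
    P.map (fun ω => (S ω).cap i) = P.map (fun ω => (S ω).cap 0) := by
  have h1 : ∀ i, P.map (fun ω => (S ω).cap i) {true} = ENNReal.ofReal γ := fun i => by
    rw [Measure.map_apply (hS.cap_measurable i) (measurableSet_singleton _), ← hS.cap_prob i]
    rfl
  have : ∀ i, IsProbabilityMeasure (P.map fun ω => (S ω).cap i) := fun i =>
    Measure.isProbabilityMeasure_map (hS.cap_measurable i).aemeasurable
  have h2 : ∀ i, P.map (fun ω => (S ω).cap i) {false} = 1 - ENNReal.ofReal γ := fun i => by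
    rw [← h1 i, ← prob_compl_eq_one_sub (measurableSet_singleton _)]
    congr 1
    ext b
    cases b <;> simp
  refine Measure.ext_of_singleton fun b => ?_
  cases b
  · rw [h2, h2]
  · rw [h1, h1]

lemma map_cap_shift (hS : IsHighway P lamV γ lamR S) (n : ℤ) :
    (P.map fun ω => (S ω).cap).map (fun c i => c (i + n)) = P.map fun ω => (S ω).cap := by
  rw [Measure.map_map (by fun_prop) hS.measurable_cap]
  have h1 := hS.cap_indep.map_fun_eq_infinitePi_map hS.cap_measurable
  have h2 := (hS.cap_indep.precomp (add_left_injective n)).map_fun_eq_infinitePi_map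
    fun i => hS.cap_measurable (i + n)
  have e : (fun i => P.map fun ω => (S ω).cap (i + n)) = fun i => P.map fun ω => (S ω).cap i := by
    ext1 i
    rw [hS.map_cap_apply, hS.map_cap_apply i]
  rw [e, ← h1] at h2
  exact h2

/-- The law of the highway is invariant under translations. -/
lemma measurePreserving_shift (hS : IsHighway P lamV γ lamR S) (hT : 0 < lamR⁻¹) (t : ℝ) :
    MeasurePreserving (HighwayState.shift hT t) (P.map fun ω => (S ω).state)
      (P.map fun ω => (S ω).state) := by
  rw [hS.map_state]
  have h1 : MeasurePreserving (fun p : (ℤ → ℝ) × (ℤ → Bool) =>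
      (shiftPos t p.1, fun i => p.2 (i + lastIndex t p.1)))
      ((P.map fun ω => (S ω).pos).prod (P.map fun ω => (S ω).cap))
      ((P.map fun ω => (S ω).pos).prod (P.map fun ω => (S ω).cap)) := by
    have : IsProbabilityMeasure (P.map fun ω => (S ω).pos) :=
      Measure.isProbabilityMeasure_map hS.measurable_pos.aemeasurable
    have : IsProbabilityMeasure (P.map fun ω => (S ω).cap) :=
      Measure.isProbabilityMeasure_map hS.measurable_cap.aemeasurable
    -- The label shift of the capabilities is random but depends only on the positions. For fixed
    -- positions it is a deterministic shift of an i.i.d. sequence.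
    refine (hS.poisson.measurePreserving_shiftPos t).skew_product
      (g := fun y (c : ℤ → Bool) i => c (i + lastIndex t y)) ?_
      (Filter.Eventually.of_forall fun y => hS.map_cap_shift (lastIndex t y))
    refine measurable_pi_iff.2 fun i => ?_
    exact (measurable_eval_add i).comp
      (measurable_snd.prodMk ((measurable_lastIndex t).comp measurable_fst))
  have h2 : MeasurePreserving (fun u => toIcoMod hT 0 (u - t)) (volume[|Set.Ico 0 lamR⁻¹])
      (volume[|Set.Ico 0 lamR⁻¹]) := by
    have := measurePreserving_toIcoMod_sub hT t
    exact ⟨this.measurable, by rw [ProbabilityTheory.cond, Measure.map_smul, this.map_eq]⟩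
  have : IsProbabilityMeasure (volume[|Set.Ico 0 lamR⁻¹]) := by
    rw [← hS.rsu_uniform.map_eq]
    exact Measure.isProbabilityMeasure_map hS.rsu_measurable.aemeasurable
  exact h1.prod h2

end IsHighway

/-! ### Measurability -/

namespace HighwayState

variable {T d : ℝ}

lemma measurable_toSnapshot_pos (i : ℤ) : Measurable fun p : HighwayState =>
    (p.toSnapshot T).pos i :=
  (measurable_pi_apply i).comp (measurable_fst.comp measurable_fst)

lemma measurable_toSnapshot_cap (i : ℤ) : Measurable fun p : HighwayState =>
    (p.toSnapshot T).cap i :=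
  (measurable_pi_apply i).comp (measurable_snd.comp measurable_fst)

lemma measurable_toSnapshot_rsu (k : ℤ) : Measurable fun p : HighwayState =>
    (p.toSnapshot T).rsu k :=
  measurable_snd.add_const _

lemma measurableSet_cap (i : ℤ) :
    MeasurableSet {p : HighwayState | (p.toSnapshot T).cap i = true} :=
  measurable_toSnapshot_cap i (measurableSet_singleton true)

lemma measurableSet_reachV2I (i k : ℤ) :
    MeasurableSet {p : HighwayState | (p.toSnapshot T).reachV2I d i k} := by
  have h : MeasurableSet {p : HighwayState |
      |(p.toSnapshot T).pos i - (p.toSnapshot T).rsu k| ≤ d} :=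
    measurableSet_le ((measurable_toSnapshot_pos i).sub (measurable_toSnapshot_rsu k)).abs
      measurable_const
  exact (measurableSet_cap i).inter h

lemma measurableSet_gap_le (i : ℤ) : MeasurableSet {p : HighwayState |
    (p.toSnapshot T).pos (i + 1) - (p.toSnapshot T).pos i ≤ 2 * d} :=
  measurableSet_le ((measurable_toSnapshot_pos _).sub (measurable_toSnapshot_pos _))
    measurable_const

lemma measurableSet_lt_gap (i : ℤ) : MeasurableSet {p : HighwayState |
    2 * d < (p.toSnapshot T).pos (i + 1) - (p.toSnapshot T).pos i} :=
  measurableSet_lt measurable_const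
    ((measurable_toSnapshot_pos _).sub (measurable_toSnapshot_pos _))

lemma measurableSet_adj (i j : ℤ) :
    MeasurableSet {p : HighwayState | ((p.toSnapshot T).v2vGraph d).Adj i j} := by
  have h1 : MeasurableSet {p : HighwayState |
      |(p.toSnapshot T).pos i - (p.toSnapshot T).pos j| ≤ d} :=
    measurableSet_le ((measurable_toSnapshot_pos i).sub (measurable_toSnapshot_pos j)).abs
      measurable_const
  have h2 : MeasurableSet {p : HighwayState | ∀ k,
      ¬ (min ((p.toSnapshot T).pos i) ((p.toSnapshot T).pos j) < (p.toSnapshot T).pos k ∧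
        (p.toSnapshot T).pos k < max ((p.toSnapshot T).pos i) ((p.toSnapshot T).pos j))} := by
    rw [Set.ofPred_forall]
    refine MeasurableSet.iInter fun k => MeasurableSet.compl ?_
    exact (measurableSet_lt ((measurable_toSnapshot_pos i).min (measurable_toSnapshot_pos j))
        (measurable_toSnapshot_pos k)).inter
      (measurableSet_lt (measurable_toSnapshot_pos k)
        ((measurable_toSnapshot_pos i).max (measurable_toSnapshot_pos j)))
  exact (MeasurableSet.const (i ≠ j)).inter ((measurableSet_cap i).inter
    ((measurableSet_cap j).inter (h1.inter h2)))

/-- Reachability is a countable union over walk lengths, and walks of a given length are handled by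
induction on the first step. -/
lemma measurableSet_reachable (i j : ℤ) :
    MeasurableSet {p : HighwayState | ((p.toSnapshot T).v2vGraph d).Reachable i j} := by
  have key : ∀ (n : ℕ) (i : ℤ), MeasurableSet {p : HighwayState |
      ∃ w : ((p.toSnapshot T).v2vGraph d).Walk i j, w.length = n} := by
    intro n
    induction n with
    | zero =>
      intro i
      simp only [SimpleGraph.Walk.exists_length_eq_zero_iff]
      exact MeasurableSet.const _
    | succ n ih =>
      intro i
      have : {p : HighwayState | ∃ w : ((p.toSnapshot T).v2vGraph d).Walk i j, w.length = n + 1} =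
          ⋃ k, {p | ((p.toSnapshot T).v2vGraph d).Adj i k} ∩
            {p | ∃ w : ((p.toSnapshot T).v2vGraph d).Walk k j, w.length = n} := by
        ext p
        simp only [Set.mem_ofPred_eq, Set.mem_iUnion, Set.mem_inter_iff]
        constructor
        · rintro ⟨w, hw⟩
          cases w with
          | nil => simp at hw
          | cons h w => exact ⟨_, h, w, by simpa using hw⟩
        · rintro ⟨k, h, w, hw⟩
          exact ⟨SimpleGraph.Walk.cons h w, by simpa using hw⟩
      rw [this]
      exact MeasurableSet.iUnion fun k => (measurableSet_adj i k).inter (ih k)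
  have : {p : HighwayState | ((p.toSnapshot T).v2vGraph d).Reachable i j} =
      ⋃ n : ℕ, {p | ∃ w : ((p.toSnapshot T).v2vGraph d).Walk i j, w.length = n} := by
    ext p
    simp only [Set.mem_ofPred_eq, Set.mem_iUnion]
    exact ⟨fun ⟨w⟩ => ⟨w.length, w, rfl⟩, fun ⟨_, w, _⟩ => ⟨w⟩⟩
  rw [this]
  exact MeasurableSet.iUnion fun n => key n i

lemma measurableSet_reachV2V (i k : ℤ) :
    MeasurableSet {p : HighwayState | (p.toSnapshot T).reachV2V d i k} := by
  simp only [Snapshot.reachV2V, Set.ofPred_exists]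
  exact MeasurableSet.iUnion fun j => (measurableSet_reachable i j).inter
    (measurableSet_reachV2I j k)

lemma measurableSet_isClusterHead (i : ℤ) :
    MeasurableSet {p : HighwayState | (p.toSnapshot T).IsClusterHead d i} := by
  have h : MeasurableSet {p : HighwayState | ∀ j, ((p.toSnapshot T).v2vGraph d).Reachable i j →
      (p.toSnapshot T).pos i ≤ (p.toSnapshot T).pos j} := by
    rw [Set.ofPred_forall]
    refine MeasurableSet.iInter fun j => ?_
    simp only [imp_iff_not_or]
    exact (measurableSet_reachable i j).compl.union
      (measurableSet_le (measurable_toSnapshot_pos i) (measurable_toSnapshot_pos j))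
  exact (measurableSet_cap i).inter h

lemma measurableSet_sameBlock (i j : ℤ) :
    MeasurableSet {p : HighwayState | (p.toSnapshot T).SameBlock d i j} := by
  simp only [Snapshot.SameBlock, Set.ofPred_forall]
  exact MeasurableSet.iInter fun k => MeasurableSet.iInter fun _ => MeasurableSet.iInter fun _ =>
    measurableSet_gap_le k

lemma measurableSet_mem_blockRSUs (i k : ℤ) :
    MeasurableSet {p : HighwayState | k ∈ (p.toSnapshot T).blockRSUs d i} := by
  simp only [Snapshot.blockRSUs, Set.mem_ofPred_eq]
  rw [Set.ofPred_exists]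
  exact MeasurableSet.iUnion fun j => (measurableSet_sameBlock i j).inter
    (measurableSet_reachV2I j k)

lemma measurable_encard {α : Type*} [MeasurableSpace α] {A : α → Set ℤ}
    (hA : ∀ k, MeasurableSet {p | k ∈ A p}) : Measurable fun p => ((A p).encard : ℝ≥0∞) := by
  classical
  have : (fun p => ((A p).encard : ℝ≥0∞)) = fun p => ∑' k, if k ∈ A p then 1 else 0 := by
    ext p
    rw [← ENNReal.tsum_set_one, tsum_subtype (A p) fun _ => 1]
    exact tsum_congr fun k => by simp only [Set.indicator_apply]
  rw [this]
  exact Measurable.tsum fun k => Measurable.ite (hA k) measurable_const measurable_const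

lemma measurableSet_isSparse (hT : 2 * d < T) :
    MeasurableSet {p : HighwayState | (p.toSnapshot T).IsSparse d} := by
  have : {p : HighwayState | (p.toSnapshot T).IsSparse d} =
      (⋂ i, {p | (p.toSnapshot T).pos i < (p.toSnapshot T).pos (i + 1)}) ∩
      ((⋂ i, ⋃ j, ⋃ _ : j ≥ i,
        {p | 2 * d < (p.toSnapshot T).pos (j + 1) - (p.toSnapshot T).pos j}) ∩
      ⋂ i, ⋃ j, ⋃ _ : j ≤ i,
        {p | 2 * d < (p.toSnapshot T).pos (j + 1) - (p.toSnapshot T).pos j}) := by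
    ext p
    simp only [Set.mem_ofPred_eq, Set.mem_inter_iff, Set.mem_iInter, Set.mem_iUnion, exists_prop,
      ← strictMono_iff_lt_add_one]
    refine ⟨fun h => ⟨h.1, h.2, h.3⟩, fun h => ⟨h.1, h.2.1, h.2.2, fun k l hkl => ?_⟩⟩
    have h1 : (1 : ℝ) ≤ |(k : ℝ) - l| := by
      exact_mod_cast Int.one_le_abs (sub_ne_zero.2 hkl)
    have h2 : (p.toSnapshot T).rsu k - (p.toSnapshot T).rsu l = (k - l) * T := by
      simp only [toSnapshot]; ring
    rw [h2, abs_mul]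
    have h3 := le_abs_self T
    have h4 := mul_le_mul_of_nonneg_right h1 (abs_nonneg T)
    linarith
  rw [this]
  refine (MeasurableSet.iInter fun i => measurableSet_lt (measurable_toSnapshot_pos _)
    (measurable_toSnapshot_pos _)).inter ((MeasurableSet.iInter fun i => ?_).inter
    (MeasurableSet.iInter fun i => ?_)) <;>
  exact MeasurableSet.iUnion fun j => MeasurableSet.iUnion fun _ => measurableSet_lt_gap j

/-- The rate is obtained by choice, so measurability comes from locality. Between two long gaps it
is a function of the finite access relation there; endpoints and relation together take countably
many values, and each case is a measurable event. -/
lemma aemeasurable_maxMinRate {μ : Measure HighwayState} (hT : 2 * d < T)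
    (hμ : ∀ᵐ p ∂μ, (HighwayState.toSnapshot T p).IsSparse d) {reach : HighwayState → ℤ → ℤ → Prop}
    (hm : ∀ i k, MeasurableSet {p | reach p i k})
    (hr : ∀ p, (toSnapshot T p).IsSparse d → (toSnapshot T p).IsAccess d (reach p))
    {ρ : ℝ≥0∞} (hρ : ρ ≠ ∞) (i : ℤ) : AEMeasurable (fun p => maxMinRate (reach p) ρ i) μ := by
  classical
  set f := fun p => maxMinRate (reach p) ρ i with hf
  set G := {p : HighwayState | (p.toSnapshot T).IsSparse d} with hG
  have hGm : MeasurableSet G := measurableSet_isSparse hT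
  let F : Finset (ℤ × ℤ) → ℝ≥0∞ := fun D => maxMinRate (fun a b => (a, b) ∈ D) ρ i
  -- Long gaps follow the vehicles `c.1` and `c.2.1`, so the vehicles enclosed are those with labels
  -- in `Set.Ioc c.1 c.2.1`; `c.2.2` records their access relation.
  let E : ℤ × ℤ × Finset (ℤ × ℤ) → Set HighwayState := fun c => G ∩
    ({p | 2 * d < (p.toSnapshot T).pos (c.1 + 1) - (p.toSnapshot T).pos c.1} ∩
    ({p | 2 * d < (p.toSnapshot T).pos (c.2.1 + 1) - (p.toSnapshot T).pos c.2.1} ∩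
    ⋂ a, ⋂ b, {p | (a ∈ Set.Ioc c.1 c.2.1 ∧ reach p a b) ↔ (a, b) ∈ c.2.2}))
  have hE : ∀ c, MeasurableSet (E c) := fun c =>
    hGm.inter ((measurableSet_lt_gap _).inter ((measurableSet_lt_gap _).inter
      (MeasurableSet.iInter fun a => MeasurableSet.iInter fun b =>
        ((MeasurableSet.const _).inter (hm a b)).iff (MeasurableSet.const _))))
  have hval : ∀ c p, p ∈ E c → i ∈ Set.Ioc c.1 c.2.1 → f p = F c.2.2 := by
    rintro ⟨m, n, D⟩ p ⟨hp, hgm, hgn, hD⟩ hi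
    simp only [Set.mem_iInter, Set.mem_ofPred_eq] at hp hgm hgn hD hi
    have hdec := (hr p hp).isDecomposition hp
    simp only [hf, F]
    rw [hdec.maxMinRate_restrict hρ (J := Set.Ioc m n) ?_ hi]
    · congr 1
      ext a b
      exact hD a b
    · intro a b k ha hak hbk
      have hab := Snapshot.block_eq_iff.1 (hdec.closed a b k hak hbk)
      obtain ⟨h1, h2⟩ := ha
      constructor <;> by_contra! h
      · exact absurd (hab m (by omega) (by omega)) (not_le.2 hgm)
      · exact absurd (hab n (by omega) (by omega)) (not_le.2 hgn)
  have hcov : ∀ p ∈ G, ∃ c, i ∈ Set.Ioc c.1 c.2.1 ∧ p ∈ E c := by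
    intro p hp
    obtain ⟨n, hn, hgn⟩ := hp.gap_right i
    obtain ⟨m, hm, hgm⟩ := hp.gap_left (i - 1)
    have hfin : {q : ℤ × ℤ | q.1 ∈ Set.Ioc m n ∧ reach p q.1 q.2}.Finite := by
      refine ((Set.finite_Ioc m n).biUnion fun a _ =>
        (((hr p hp).isDecomposition hp).finite_reach a).image (Prod.mk a)).subset ?_
      rintro ⟨a, b⟩ ⟨ha, hab⟩
      exact Set.mem_biUnion ha ⟨b, hab, rfl⟩
    refine ⟨(m, n, hfin.toFinset), ⟨by simp only; omega, hn⟩, hp, hgm, hgn, ?_⟩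
    simp
  have hmeas : ∀ B, MeasurableSet (f ⁻¹' B ∩ G) := by
    intro B
    have : f ⁻¹' B ∩ G = ⋃ c : ℤ × ℤ × Finset (ℤ × ℤ), ⋃ _ : i ∈ Set.Ioc c.1 c.2.1 ∧ F c.2.2 ∈ B,
        E c := by
      ext p
      simp only [Set.mem_inter_iff, Set.mem_preimage, Set.mem_iUnion, exists_prop]
      constructor
      · rintro ⟨hB, hp⟩
        obtain ⟨c, hi, hc⟩ := hcov p hp
        exact ⟨c, ⟨hi, by rwa [← hval c p hc hi]⟩, hc⟩
      · rintro ⟨c, ⟨hi, hB⟩, hc⟩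
        exact ⟨by rwa [hval c p hc hi], hc.1⟩
    rw [this]
    exact MeasurableSet.iUnion fun c => MeasurableSet.iUnion fun _ => hE c
  refine ⟨G.indicator f, fun B hB => ?_, ?_⟩
  · rw [Set.indicator_preimage, Set.ite]
    exact (hmeas B).union ((measurable_const hB).diff hGm)
  · filter_upwards [hμ] with p hp
    rw [Set.indicator_of_mem (by exact hp)]

end HighwayState

namespace IsHighway

variable {Ω : Type*} [MeasurableSpace Ω] {P : Measure Ω} {lamV γ lamR : ℝ} {S : Ω → Snapshot}
  [IsProbabilityMeasure P]

lemma ae_isSparse (hS : IsHighway P lamV γ lamR S) {d : ℝ} (hd : 0 < d) (hT : 2 * d < lamR⁻¹) :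
    ∀ᵐ ω ∂P, (S ω).IsSparse d := by
  filter_upwards [hS.poisson.ae_gap_right (L := 2 * d) (by linarith),
    hS.poisson.ae_gap_left (L := 2 * d) (by linarith)] with ω h1 h2
  refine ⟨hS.poisson.strictMono ω, h1, h2, fun k l hkl => ?_⟩
  rw [hS.rsu_grid ω k, hS.rsu_grid ω l, add_sub_add_left_eq_sub, ← sub_mul, abs_mul]
  have h1 : (1 : ℝ) ≤ |(k : ℝ) - l| := by
    exact_mod_cast Int.one_le_abs (sub_ne_zero.2 hkl)
  have h3 := le_abs_self lamR⁻¹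
  have h4 := mul_le_mul_of_nonneg_right h1 (abs_nonneg lamR⁻¹)
  linarith

lemma ae_map_isSparse (hS : IsHighway P lamV γ lamR S) {d : ℝ} (hd : 0 < d)
    (hT : 2 * d < lamR⁻¹) :
    ∀ᵐ p ∂(P.map fun ω => (S ω).state), (p.toSnapshot lamR⁻¹).IsSparse d := by
  rw [ae_map_iff hS.measurable_state.aemeasurable (HighwayState.measurableSet_isSparse hT)]
  simpa only [hS.toSnapshot_state] using hS.ae_isSparse hd hT

end IsHighway

/-! ### Mass transport -/

/-- The indicator of the unit interval starting at `n`. -/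
noncomputable def unitWindow (n : ℤ) : ℝ → ℝ≥0∞ := (Set.Ico (n : ℝ) (n + 1)).indicator 1

lemma measurable_unitWindow (n : ℤ) : Measurable (unitWindow n) :=
  measurable_one.indicator measurableSet_Ico

lemma tsum_unitWindow (r : ℝ) : ∑' n, unitWindow n r = 1 := by
  rw [tsum_eq_single ⌊r⌋]
  · exact Set.indicator_of_mem (Set.mem_Ico.2 ⟨Int.floor_le r, Int.lt_floor_add_one r⟩) _
  · intro n hn
    refine Set.indicator_of_notMem (fun h => hn ?_) _
    exact (Int.floor_eq_iff.2 (Set.mem_Ico.1 h)).symm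

lemma unitWindow_sub (n k : ℤ) (r : ℝ) : unitWindow n (r - k) = unitWindow (n + k) r := by
  simp only [unitWindow, Set.indicator_apply, Set.mem_Ico]
  push_cast
  congr 1
  rw [eq_iff_iff]
  constructor <;> rintro ⟨h1, h2⟩ <;> constructor <;> linarith

/-- The mass transport principle: the mean mass sent from the unit window equals the mean mass
received in it. -/
lemma IsHighway.mass_transport {Ω : Type*} [MeasurableSpace Ω] {P : Measure Ω}
    [IsProbabilityMeasure P] {lamV γ lamR : ℝ} {S : Ω → Snapshot}
    (hS : IsHighway P lamV γ lamR S) (hT : 0 < lamR⁻¹)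
    {m : HighwayState → ℤ → ℤ → ℝ≥0∞} {x y : HighwayState → ℤ → ℝ}
    (hm : ∀ i j, AEMeasurable (fun p => m p i j) (P.map fun ω => (S ω).state))
    (hx : ∀ i, Measurable fun p => x p i) (hy : ∀ j, Measurable fun p => y p j)
    (heq : ∀ᵐ p ∂(P.map fun ω => (S ω).state), ∀ t, ∃ a b : ℤ,
      (∀ i j, m (HighwayState.shift hT t p) i j = m p (i + a) (j + b)) ∧
      (∀ i, x (HighwayState.shift hT t p) i = x p (i + a) - t) ∧
      ∀ j, y (HighwayState.shift hT t p) j = y p (j + b) - t) :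
    ∫⁻ p, ∑' i, unitWindow 0 (x p i) * ∑' j, m p i j ∂(P.map fun ω => (S ω).state) =
      ∫⁻ p, ∑' j, unitWindow 0 (y p j) * ∑' i, m p i j ∂(P.map fun ω => (S ω).state) := by
  set μ := P.map fun ω => (S ω).state with hμ
  -- Mass sent from the unit window at `k` to the unit window at `l`. Outgoing mass sums `Φ 0 n`,
  -- incoming mass sums `Φ (-n) 0`, and translation by `n` identifies their means.
  let Φ : ℤ → ℤ → HighwayState → ℝ≥0∞ := fun k l p =>
    ∑' i, ∑' j, unitWindow k (x p i) * unitWindow l (y p j) * m p i j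
  have hΦ : ∀ k l, AEMeasurable (Φ k l) μ := fun k l =>
    AEMeasurable.tsum fun i => AEMeasurable.tsum fun j =>
      ((((measurable_unitWindow k).comp (hx i)).mul
        ((measurable_unitWindow l).comp (hy j))).aemeasurable.mul (hm i j))
  have h1 : ∀ p, ∑' i, unitWindow 0 (x p i) * ∑' j, m p i j = ∑' n, Φ 0 n p := by
    intro p
    simp only [Φ]
    rw [ENNReal.tsum_comm]
    refine tsum_congr fun i => ?_
    rw [ENNReal.tsum_comm, ← ENNReal.tsum_mul_left]
    refine tsum_congr fun j => ?_
    simp_rw [mul_right_comm _ _ (m p i j)]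
    rw [ENNReal.tsum_mul_left, tsum_unitWindow, mul_one]
  have h2 : ∀ p, ∑' j, unitWindow 0 (y p j) * ∑' i, m p i j = ∑' n, Φ (-n) 0 p := by
    intro p
    rw [show ∑' n, Φ (-n) 0 p = ∑' n, Φ n 0 p from (Equiv.neg ℤ).tsum_eq fun n => Φ n 0 p]
    simp only [Φ]
    simp_rw [ENNReal.tsum_comm (f := fun i j => unitWindow _ (x p i) * unitWindow 0 (y p j) *
      m p i j)]
    rw [ENNReal.tsum_comm]
    refine tsum_congr fun j => ?_
    rw [ENNReal.tsum_comm, ← ENNReal.tsum_mul_left]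
    refine tsum_congr fun i => ?_
    simp_rw [mul_assoc]
    rw [ENNReal.tsum_mul_right, tsum_unitWindow, one_mul]
  simp_rw [h1, h2]
  rw [lintegral_tsum fun n => hΦ 0 n, lintegral_tsum fun n => hΦ (-n) 0]
  refine tsum_congr fun n => ?_
  have hp := hS.measurePreserving_shift hT n
  rw [← hμ] at hp
  have h3 : ∫⁻ p, Φ (-n) 0 p ∂μ = ∫⁻ p, Φ (-n) 0 (HighwayState.shift hT n p) ∂μ := by
    conv_lhs => rw [← hp.map_eq]
    exact lintegral_map' (by rw [hp.map_eq]; exact hΦ _ _) hp.measurable.aemeasurable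
  rw [h3]
  refine lintegral_congr_ae ?_
  filter_upwards [heq] with p hp
  obtain ⟨a, b, hm, hx, hy⟩ := hp n
  simp only [Φ, hm, hx, hy, unitWindow_sub, neg_add_cancel, zero_add]
  rw [← (Equiv.addRight a).tsum_eq]
  refine tsum_congr fun i => ?_
  rw [← (Equiv.addRight b).tsum_eq]
  rfl

/-! ### Access rules common to both networks -/

/-- A rule deciding which RSUs the capable vehicles may use, given by the relative positions of
vehicles and RSUs, and between V2I access and sharing within blocks. -/
structure IsAccessRule (T d : ℝ) (reach : Snapshot → ℤ → ℤ → Prop) : Prop where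
  isAccess : ∀ s : Snapshot, s.IsSparse d → s.IsAccess d (reach s)
  cap : ∀ (s : Snapshot) (i k : ℤ), reach s i k → s.cap i = true
  relabel : ∀ {s s' : Snapshot} {a b : ℤ} {t : ℝ}, s.IsRelabel s' a b t →
    ∀ i k, reach s' i k ↔ reach s (i + a) (k + b)
  measurableSet : ∀ i k, MeasurableSet {p : HighwayState | reach (p.toSnapshot T) i k}

lemma isAccessRule_reachV2I (T d : ℝ) : IsAccessRule T d fun s => s.reachV2I d where
  isAccess _ _ := Snapshot.isAccess_reachV2I
  cap _ _ _ h := h.1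
  relabel h := h.reachV2I
  measurableSet := HighwayState.measurableSet_reachV2I

lemma isAccessRule_reachV2V (T : ℝ) {d : ℝ} (hd : 0 < d) :
    IsAccessRule T d fun s => s.reachV2V d where
  isAccess _ hs := hs.isAccess_reachV2V hd
  cap := fun _ _ _ ⟨_, hj, hk⟩ => Snapshot.cap_of_reachable hj.symm hk.1
  relabel h := h.reachV2V
  measurableSet := HighwayState.measurableSet_reachV2V

namespace IsAccessRule

variable {T d : ℝ} {reach : Snapshot → ℤ → ℤ → Prop} {ρ : ℝ≥0∞}

lemma existsUnique (hr : IsAccessRule T d reach) {s : Snapshot} (hs : s.IsSparse d)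
    (hρ : ρ ≠ ∞) : ∃! R, IsMaxMinFair (reach s) ρ R :=
  ((hr.isAccess s hs).isDecomposition hs).existsUnique hρ

lemma aemeasurable (hr : IsAccessRule T d reach) {μ : Measure HighwayState} (hT : 2 * d < T)
    (hμ : ∀ᵐ p ∂μ, (HighwayState.toSnapshot T p).IsSparse d) (hρ : ρ ≠ ∞) (i : ℤ) :
    AEMeasurable (fun p => maxMinRate (reach (HighwayState.toSnapshot T p)) ρ i) μ :=
  HighwayState.aemeasurable_maxMinRate hT hμ hr.measurableSet
    (fun _ hp => hr.isAccess _ hp) hρ i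

lemma maxMinRate_relabel (hr : IsAccessRule T d reach) {s s' : Snapshot} {a b : ℤ} {t : ℝ}
    (h : s.IsRelabel s' a b t) (hs : s.IsSparse d) (hρ : ρ ≠ ∞) (i : ℤ) :
    maxMinRate (reach s') ρ i = maxMinRate (reach s) ρ (i + a) := by
  have e : reach s' = fun i k => reach s (Equiv.addRight a i) (Equiv.addRight b k) := by
    ext i k; exact hr.relabel h i k
  rw [e, _root_.maxMinRate_relabel (hr.existsUnique hs hρ)]
  rfl

lemma maxMinRate_eq_zero (hr : IsAccessRule T d reach) {s : Snapshot} (hs : s.IsSparse d)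
    (hρ : ρ ≠ ∞) {i : ℤ} (hi : ¬ s.cap i = true) : maxMinRate (reach s) ρ i = 0 := by
  obtain ⟨a, h0, _, h2⟩ := (isMaxMinFair_maxMinRate (hr.existsUnique hs hρ).exists).1
  rw [h2, ENNReal.tsum_eq_zero]
  exact fun k => h0 i k fun h => hi (hr.cap s i k h)

end IsAccessRule

/-! ### Mean usable capacity per unit length -/

section Poisson

open Real in
lemma lintegral_pow_poissonMeasure (r : NNReal) {q : ℝ} (hq : 0 ≤ q) :
    ∫⁻ n, ENNReal.ofReal q ^ n ∂(poissonMeasure r) = ENNReal.ofReal (exp (-(r * (1 - q)))) := by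
  rw [lintegral_countable']
  have h : ∀ n : ℕ, ENNReal.ofReal q ^ n * poissonMeasure r {n} =
      ENNReal.ofReal (exp (-r) * ((r * q) ^ n / n.factorial)) := by
    intro n
    rw [poissonMeasure_singleton, ← ENNReal.ofReal_pow hq, ← ENNReal.ofReal_mul (by positivity)]
    congr 1
    rw [mul_pow]
    ring
  simp_rw [h]
  have hs : HasSum (fun n : ℕ => exp (-r) * ((r * q) ^ n / n.factorial))
      (exp (-r) * exp (r * q)) := by
    rw [Real.exp_eq_exp_ℝ]
    exact (NormedSpace.expSeries_div_hasSum_exp (r * q : ℝ)).mul_left _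
  rw [← ENNReal.ofReal_tsum_of_nonneg (fun n => by positivity) hs.summable, hs.tsum_eq,
    ← Real.exp_add]
  ring_nf

lemma lintegral_natCast_poissonMeasure (r : NNReal) :
    ∫⁻ n, (n : ℝ≥0∞) ∂(poissonMeasure r) = r := by
  rw [lintegral_countable', tsum_eq_zero_add' ENNReal.summable]
  have h : ∀ n : ℕ, ((n + 1 : ℕ) : ℝ≥0∞) * poissonMeasure r {n + 1} =
      r * poissonMeasure r {n} := by
    intro n
    rw [poissonMeasure_singleton, poissonMeasure_singleton, ← ENNReal.ofReal_natCast,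
      ← ENNReal.ofReal_mul (by positivity), ← ENNReal.ofReal_coe_nnreal,
      ← ENNReal.ofReal_mul (by positivity)]
    congr 1
    rw [Nat.factorial_succ]
    push_cast
    have : (n.factorial : ℝ) ≠ 0 := by positivity
    field_simp
    ring
  simp_rw [h]
  rw [ENNReal.tsum_mul_left]
  have h1 := lintegral_countable' (μ := poissonMeasure r) fun _ => 1
  simp only [lintegral_const, measure_univ, one_mul] at h1
  rw [← h1]
  simp

end Poisson

/-- Summing a window over the points of a uniformly random grid. -/
lemma tsum_lintegral_grid {T : ℝ} (hT : 0 < T) {f : ℝ → ℝ≥0∞} (hf : Measurable f) :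
    ∑' k : ℤ, ∫⁻ u, f (u + k * T) ∂(volume[|Set.Ico 0 T]) =
      (ENNReal.ofReal T)⁻¹ * ∫⁻ u, f u := by
  simp only [ProbabilityTheory.cond, lintegral_smul_measure, Real.volume_Ico, sub_zero,
    smul_eq_mul]
  rw [ENNReal.tsum_mul_left]
  congr 1
  have h1 : ∀ k : ℤ, ∫⁻ u in Set.Ico 0 T, f (u + k * T) =
      ∫⁻ u in Set.Ico (k • T) ((k + 1) • T), f u := by
    intro k
    have hp := (measurePreserving_add_right volume (k * T)).restrict_preimage
      (measurableSet_Ico (a := k • T) (b := (k + 1) • T))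
    rw [← hp.lintegral_comp hf]
    congr 2
    ext u
    simp only [Set.mem_preimage, Set.mem_Ico, zsmul_eq_mul]
    push_cast
    constructor <;> rintro ⟨h1, h2⟩ <;> constructor <;> linarith
  simp_rw [h1]
  rw [← lintegral_iUnion (fun k => measurableSet_Ico) (Set.pairwise_disjoint_Ico_zsmul T),
    iUnion_Ico_zsmul hT, Measure.restrict_univ]

lemma lintegral_unitWindow : ∫⁻ u, unitWindow 0 u = 1 := by
  rw [unitWindow, lintegral_indicator_one measurableSet_Ico]
  simp

namespace IsHighway

variable {Ω : Type*} [MeasurableSpace Ω] {P : Measure Ω} {lamV γ lamR : ℝ} {S : Ω → Snapshot}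
  [IsProbabilityMeasure P]

lemma isProbabilityMeasure_map_pos (hS : IsHighway P lamV γ lamR S) :
    IsProbabilityMeasure (P.map fun ω => (S ω).pos) :=
  Measure.isProbabilityMeasure_map hS.measurable_pos.aemeasurable

lemma isProbabilityMeasure_map_cap (hS : IsHighway P lamV γ lamR S) :
    IsProbabilityMeasure (P.map fun ω => (S ω).cap) :=
  Measure.isProbabilityMeasure_map hS.measurable_cap.aemeasurable

lemma measure_forall_not_cap (hS : IsHighway P lamV γ lamR S) (hγ : 0 ≤ γ) (s : Finset ℤ) :
    P {ω | ∀ j ∈ s, (S ω).cap j = false} = ENNReal.ofReal (1 - γ) ^ s.card := by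
  have h1 := hS.cap_indep.measure_inter_preimage_eq_mul s (sets := fun _ => {false})
    fun _ _ => measurableSet_singleton _
  have h2 : ∀ j, P ((fun ω => (S ω).cap j) ⁻¹' {false}) = ENNReal.ofReal (1 - γ) := by
    intro j
    have : (fun ω => (S ω).cap j) ⁻¹' {false} = {ω | (S ω).cap j = true}ᶜ := by
      ext ω; simp
    have hm : MeasurableSet {ω | (S ω).cap j = true} :=
      hS.cap_measurable j (measurableSet_singleton true)
    rw [this, prob_compl_eq_one_sub hm, hS.cap_prob, ENNReal.ofReal_sub _ hγ, ENNReal.ofReal_one]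
  simp only [h2, Finset.prod_const] at h1
  rw [← h1]
  congr 1
  ext ω
  simp

/-- The probability that some capable vehicle is within distance `d` of a given location. -/
lemma measure_exists_cap (hS : IsHighway P lamV γ lamR S) (hγ : 0 ≤ γ) (hγ1 : γ ≤ 1)
    (hlam : 0 ≤ lamV) {d : ℝ} (hd : 0 ≤ d) (r : ℝ) :
    ((P.map fun ω => (S ω).pos).prod (P.map fun ω => (S ω).cap))
      {q | ∃ j, q.2 j = true ∧ |q.1 j - r| ≤ d} =
      ENNReal.ofReal (1 - Real.exp (-2 * γ * lamV * d)) := by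
  have := hS.isProbabilityMeasure_map_pos
  have := hS.isProbabilityMeasure_map_cap
  set A : Set ((ℤ → ℝ) × (ℤ → Bool)) := {q | ∃ j, q.2 j = true ∧ |q.1 j - r| ≤ d} with hA
  have hAm : MeasurableSet A := by
    have : A = ⋃ j, {q | q.2 j = true} ∩ {q | |q.1 j - r| ≤ d} := by
      ext q; simp [hA]
    rw [this]
    refine MeasurableSet.iUnion fun j => MeasurableSet.inter ?_ ?_
    · have h : Measurable fun q : (ℤ → ℝ) × (ℤ → Bool) => q.2 j := by fun_prop
      exact h (measurableSet_singleton true)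
    · have h : Measurable fun q : (ℤ → ℝ) × (ℤ → Bool) => |q.1 j - r| := by fun_prop
      exact measurableSet_le h measurable_const
  have hc : ((P.map fun ω => (S ω).pos).prod (P.map fun ω => (S ω).cap)) Aᶜ =
      ENNReal.ofReal (Real.exp (-2 * γ * lamV * d)) := by
    rw [Measure.prod_apply hAm.compl, lintegral_map (measurable_measure_prodMk_left hAm.compl)
      hS.measurable_pos]
    -- Given the positions, all vehicles in the interval are legacy with probability `(1 - γ)` to
    -- the power of their number. The Poisson generating function at `1 - γ` then produces the
    -- exponential.
    have h1 : ∀ ω, (P.map fun ω => (S ω).cap) (Prod.mk (S ω).pos ⁻¹' Aᶜ) =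
        ENNReal.ofReal (1 - γ) ^ {i | (S ω).pos i ∈ Set.Icc (r - d) (r + d)}.ncard := by
      intro ω
      have hf := hS.poisson.locallyFinite ω (r - d) (r + d)
      rw [Measure.map_apply hS.measurable_cap (measurable_prodMk_left hAm.compl),
        Set.ncard_eq_toFinset_card _ hf, ← hS.measure_forall_not_cap hγ]
      congr 1
      ext ω'
      simp only [hA, Set.mem_preimage, Set.mem_compl_iff, Set.mem_ofPred_eq, not_exists, not_and,
        Set.Finite.mem_toFinset, Set.mem_Icc, abs_le]
      refine forall_congr' fun j => ?_
      constructor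
      · intro h hj
        rw [← Bool.not_eq_true]
        exact fun h' => h h' (by linarith [hj.1]) (by linarith [hj.2])
      · intro h h' hj hj'
        rw [h ⟨by linarith, by linarith⟩] at h'
        exact absurd h' (by simp)
    simp_rw [h1]
    have h2 := hS.poisson.count (Set.Icc (r - d) (r + d)) measurableSet_Icc
      (Metric.isBounded_Icc _ _)
    rw [← lintegral_map' (f := fun n : ℕ => ENNReal.ofReal (1 - γ) ^ n)
      (measurable_of_countable _).aemeasurable h2.aemeasurable, h2.map_eq,
      lintegral_pow_poissonMeasure _ (by linarith)]
    rw [Real.volume_real_Icc_of_le (by linarith), Real.coe_toNNReal _ (by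
      have : 0 ≤ r + d - (r - d) := by linarith
      positivity)]
    congr 2
    ring
  rw [← compl_compl A, prob_compl_eq_one_sub hAm.compl, hc, ENNReal.ofReal_sub _
    (Real.exp_pos _).le, ENNReal.ofReal_one]

open Classical in
/-- The mean capacity of the RSUs in the unit window that are within range of a capable
vehicle. -/
lemma lintegral_capacity (hS : IsHighway P lamV γ lamR S) (hγ : 0 ≤ γ) (hγ1 : γ ≤ 1)
    (hlam : 0 ≤ lamV) (hT : 0 < lamR⁻¹) {d : ℝ} (hd : 0 ≤ d) (ρ : ℝ≥0∞) :
    ∫⁻ p, ∑' k, unitWindow 0 ((p.toSnapshot lamR⁻¹).rsu k) *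
        (if ∃ j, (p.toSnapshot lamR⁻¹).reachV2I d j k then ρ else 0)
        ∂(P.map fun ω => (S ω).state) =
      ρ * ENNReal.ofReal (1 - Real.exp (-2 * γ * lamV * d)) * (ENNReal.ofReal lamR⁻¹)⁻¹ := by
  have := hS.isProbabilityMeasure_map_pos
  have := hS.isProbabilityMeasure_map_cap
  have : IsProbabilityMeasure (volume[|Set.Ico 0 lamR⁻¹]) := by
    rw [← hS.rsu_uniform.map_eq]
    exact Measure.isProbabilityMeasure_map hS.rsu_measurable.aemeasurable
  have hset : ∀ k, MeasurableSet {p : HighwayState |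
      ∃ j, (p.toSnapshot lamR⁻¹).reachV2I d j k} := by
    intro k
    rw [Set.ofPred_exists]
    exact MeasurableSet.iUnion fun j => HighwayState.measurableSet_reachV2I j k
  have hm : ∀ k, Measurable fun p : HighwayState => unitWindow 0 ((p.toSnapshot lamR⁻¹).rsu k) *
      (if ∃ j, (p.toSnapshot lamR⁻¹).reachV2I d j k then ρ else 0) := fun k =>
    ((measurable_unitWindow 0).comp (HighwayState.measurable_toSnapshot_rsu k)).mul
      (Measurable.ite (hset k) measurable_const measurable_const)
  rw [lintegral_tsum fun k => (hm k).aemeasurable, hS.map_state]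
  have h1 : ∀ k : ℤ, ∫⁻ p, unitWindow 0 ((HighwayState.toSnapshot lamR⁻¹ p).rsu k) *
      (if ∃ j, (HighwayState.toSnapshot lamR⁻¹ p).reachV2I d j k then ρ else 0)
      ∂(((P.map fun ω => (S ω).pos).prod (P.map fun ω => (S ω).cap)).prod
        (volume[|Set.Ico 0 lamR⁻¹])) =
      ρ * ENNReal.ofReal (1 - Real.exp (-2 * γ * lamV * d)) *
        ∫⁻ u, unitWindow 0 (u + k * lamR⁻¹) ∂(volume[|Set.Ico 0 lamR⁻¹]) := by
    intro k
    have hw : Measurable fun u : ℝ => unitWindow 0 (u + k * lamR⁻¹) :=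
      (measurable_unitWindow 0).comp (measurable_id.add_const _)
    rw [lintegral_prod_symm' _ (hm k), ← lintegral_const_mul _ hw]
    refine lintegral_congr fun u => ?_
    have h2 : ∀ q : (ℤ → ℝ) × (ℤ → Bool),
        (if ∃ j, (HighwayState.toSnapshot lamR⁻¹ (q, u)).reachV2I d j k then ρ else 0) =
        {q : (ℤ → ℝ) × (ℤ → Bool) | ∃ j, q.2 j = true ∧ |q.1 j - (u + k * lamR⁻¹)| ≤ d}.indicator
          (fun _ => ρ) q := by
      intro q
      simp only [Set.indicator_apply]
      rfl
    have hq : MeasurableSet {q : (ℤ → ℝ) × (ℤ → Bool) |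
        ∃ j, q.2 j = true ∧ |q.1 j - (u + k * lamR⁻¹)| ≤ d} :=
      measurable_prodMk_right (y := u) (hset k)
    have h3 : ∀ q : (ℤ → ℝ) × (ℤ → Bool),
        unitWindow 0 ((HighwayState.toSnapshot lamR⁻¹ (q, u)).rsu k) =
          unitWindow 0 (u + k * lamR⁻¹) := fun q => rfl
    simp_rw [h2, h3]
    rw [lintegral_const_mul _ (measurable_const.indicator hq), lintegral_indicator_const hq,
      hS.measure_exists_cap hγ hγ1 hlam hd]
    exact mul_comm _ _
  simp_rw [h1]
  rw [ENNReal.tsum_mul_left, tsum_lintegral_grid hT (measurable_unitWindow 0),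
    lintegral_unitWindow, mul_one]

end IsHighway

/-! ### Window sums of rates and of cluster quantities -/

section Window

variable {Ω : Type*} [MeasurableSpace Ω] {P : Measure Ω} {S : Ω → Snapshot}

lemma windowSum_mono_ae {sel : Snapshot → ℤ → Prop} {f g : Snapshot → ℤ → ℝ≥0∞}
    (h : ∀ᵐ ω ∂P, ∀ i, sel (S ω) i → f (S ω) i ≤ g (S ω) i) :
    windowSum P S sel f ≤ windowSum P S sel g := by
  refine lintegral_mono_ae ?_
  filter_upwards [h] with ω hω
  refine ENNReal.tsum_le_tsum fun i => ?_
  split_ifs with hi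
  · exact hω i hi.1
  · exact le_rfl

lemma windowSum_const_mul {sel : Snapshot → ℤ → Prop} {f : Snapshot → ℤ → ℝ≥0∞} {c : ℝ≥0∞}
    (hc : c ≠ ∞) : windowSum P S sel (fun s i => c * f s i) = c * windowSum P S sel f := by
  rw [windowSum, windowSum, ← lintegral_const_mul' _ _ hc]
  refine lintegral_congr fun ω => ?_
  rw [← ENNReal.tsum_mul_left]
  exact tsum_congr fun i => by rw [mul_ite, mul_zero]

end Window

lemma AEMeasurable.ite_zero {α : Type*} [MeasurableSpace α] {μ : Measure α} {f : α → ℝ≥0∞}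
    (hf : AEMeasurable f μ) {q : α → Prop} {_ : DecidablePred q}
    (hq : MeasurableSet {x | q x}) : AEMeasurable (fun x => if q x then f x else 0) μ := by
  refine (hf.indicator hq).congr (Filter.Eventually.of_forall fun x => ?_)
  simp only [Set.indicator_apply, Set.mem_ofPred_eq]

namespace IsHighway

variable {Ω : Type*} [MeasurableSpace Ω] {P : Measure Ω} {lamV γ lamR : ℝ} {S : Ω → Snapshot}

-- Passing to the law of the state is what makes translation invariance, and hence mass transport,
-- applicable to window sums.
open Classical in
lemma windowSum_eq (hS : IsHighway P lamV γ lamR S) {sel : Snapshot → ℤ → Prop}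
    {f : Snapshot → ℤ → ℝ≥0∞}
    (hm : ∀ i, AEMeasurable (fun p : HighwayState => if sel (p.toSnapshot lamR⁻¹) i then
      f (p.toSnapshot lamR⁻¹) i else 0) (P.map fun ω => (S ω).state)) :
    windowSum P S sel f = ∫⁻ p, ∑' i, unitWindow 0 ((p.toSnapshot lamR⁻¹).pos i) *
      (if sel (p.toSnapshot lamR⁻¹) i then f (p.toSnapshot lamR⁻¹) i else 0)
      ∂(P.map fun ω => (S ω).state) := by
  rw [lintegral_map' ?_ hS.measurable_state.aemeasurable, windowSum]
  · refine lintegral_congr fun ω => tsum_congr fun i => ?_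
    rw [hS.toSnapshot_state ω]
    by_cases h1 : sel (S ω) i <;> by_cases h2 : (S ω).pos i ∈ Set.Ico (0 : ℝ) 1 <;>
      simp [unitWindow, h1, h2]
  · exact AEMeasurable.tsum fun i => (((measurable_unitWindow 0).comp
      (HighwayState.measurable_toSnapshot_pos i)).aemeasurable.mul (hm i))

variable [IsProbabilityMeasure P]

omit [IsProbabilityMeasure P] in
/-- The mean number of capable vehicles per unit length. -/
lemma windowSum_cap_one (hS : IsHighway P lamV γ lamR S) :
    windowSum P S (fun s i => s.cap i = true) (fun _ _ => 1) =
      ENNReal.ofReal γ * ENNReal.ofReal lamV := by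
  classical
  have hA : ∀ i, MeasurableSet {ω | (S ω).pos i ∈ Set.Ico (0 : ℝ) 1} := fun i =>
    hS.poisson.measurable i measurableSet_Ico
  have hC : ∀ i, MeasurableSet {ω | (S ω).cap i = true} := fun i =>
    hS.cap_measurable i (measurableSet_singleton true)
  have h1 : ∀ i, P {ω | (S ω).cap i = true ∧ (S ω).pos i ∈ Set.Ico (0 : ℝ) 1} =
      ENNReal.ofReal γ * P {ω | (S ω).pos i ∈ Set.Ico (0 : ℝ) 1} := by
    intro i
    have h := hS.cap_indep_pos.measure_inter_preimage_eq_mul {y | y i ∈ Set.Ico (0 : ℝ) 1}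
      ((fun c => c i) ⁻¹' {true}) ((measurable_pi_apply i) measurableSet_Ico)
      ((measurable_pi_apply i) (measurableSet_singleton true))
    rw [← hS.cap_prob i, mul_comm, Set.ofPred_and, Set.inter_comm]
    exact h
  have h2 : ∀ ω, ∑' i, (if (S ω).pos i ∈ Set.Ico (0 : ℝ) 1 then (1 : ℝ≥0∞) else 0) =
      ({i | (S ω).pos i ∈ Set.Ico (0 : ℝ) 1}.ncard : ℝ≥0∞) := by
    intro ω
    have hf := hS.poisson.finite_of_isBounded ω (Metric.isBounded_Ico (0 : ℝ) 1)
    have h3 := ENNReal.tsum_set_one {i | (S ω).pos i ∈ Set.Ico (0 : ℝ) 1}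
    rw [tsum_subtype {i | (S ω).pos i ∈ Set.Ico (0 : ℝ) 1} fun _ => 1] at h3
    rw [← hf.cast_ncard_eq] at h3
    simpa only [Set.indicator_apply, Set.mem_ofPred_eq, ENat.toENNReal_coe] using h3
  have h4 : ∑' i, P {ω | (S ω).pos i ∈ Set.Ico (0 : ℝ) 1} = ENNReal.ofReal lamV := by
    have h5 := hS.poisson.count (Set.Ico 0 1) measurableSet_Ico (Metric.isBounded_Ico _ _)
    have h6 : ∫⁻ ω, ∑' i, (if (S ω).pos i ∈ Set.Ico (0 : ℝ) 1 then (1 : ℝ≥0∞) else 0) ∂P =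
        ENNReal.ofReal lamV := by
      simp_rw [h2]
      rw [← lintegral_map' (f := fun n : ℕ => (n : ℝ≥0∞))
        (measurable_of_countable _).aemeasurable h5.aemeasurable, h5.map_eq,
        lintegral_natCast_poissonMeasure]
      simp [ENNReal.ofReal]
    rw [← h6, lintegral_tsum fun i =>
      (Measurable.ite (hA i) measurable_const measurable_const).aemeasurable]
    refine tsum_congr fun i => ?_
    rw [← lintegral_indicator_one (hA i)]
    exact lintegral_congr fun ω => by simp only [Set.indicator_apply]; rfl
  have h5 : windowSum P S (fun s i => s.cap i = true) (fun _ _ => 1) = ∫⁻ ω, ∑' i,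
      ({ω | (S ω).cap i = true} ∩ {ω | (S ω).pos i ∈ Set.Ico (0 : ℝ) 1}).indicator 1 ω ∂P := by
    refine lintegral_congr fun ω => tsum_congr fun i => ?_
    by_cases h1 : (S ω).cap i = true <;> by_cases h2 : (S ω).pos i ∈ Set.Ico (0 : ℝ) 1 <;>
      simp [-Set.mem_Ico, h1, h2]
  rw [h5, lintegral_tsum fun i =>
    (measurable_one.indicator ((hC i).inter (hA i))).aemeasurable, ← h4, ← ENNReal.tsum_mul_left]
  refine tsum_congr fun i => ?_
  rw [← h1, lintegral_indicator_one ((hC i).inter (hA i))]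
  rfl

/-- The mean total rate of the capable vehicles per unit length. -/
lemma windowSum_rate (hS : IsHighway P lamV γ lamR S) (hγ : 0 ≤ γ) (hγ1 : γ ≤ 1)
    (hlam : 0 ≤ lamV) {d : ℝ} (hd : 0 < d) (hT : 2 * d < lamR⁻¹)
    {reach : Snapshot → ℤ → ℤ → Prop} (hr : IsAccessRule lamR⁻¹ d reach) {ρ : ℝ≥0∞}
    (hρ : ρ ≠ ∞) :
    windowSum P S (fun s i => s.cap i = true) (fun s i => maxMinRate (reach s) ρ i) =
      ρ * ENNReal.ofReal (1 - Real.exp (-2 * γ * lamV * d)) * (ENNReal.ofReal lamR⁻¹)⁻¹ := by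
  classical
  have hT0 : 0 < lamR⁻¹ := by linarith
  have hsp := hS.ae_map_isSparse hd hT
  have hR := fun i => hr.aemeasurable hT hsp hρ i
  rw [← hS.lintegral_capacity hγ hγ1 hlam hT0 hd.le, hS.windowSum_eq fun i => ?_]
  swap
  · exact (hR i).ite_zero (HighwayState.measurableSet_cap i)
  -- Vehicle `i` sends `rsuShare` to RSU `k`: what leaves a vehicle is its rate, what reaches an RSU
  -- is `ρ` or `0`.
  have hmt := hS.mass_transport hT0
    (m := fun p => (p.toSnapshot lamR⁻¹).rsuShare d (reach (p.toSnapshot lamR⁻¹)) ρ)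
    (x := fun p => (p.toSnapshot lamR⁻¹).pos) (y := fun p => (p.toSnapshot lamR⁻¹).rsu)
    (fun i k => ?_) HighwayState.measurable_toSnapshot_pos HighwayState.measurable_toSnapshot_rsu ?_
  · refine Eq.trans (lintegral_congr_ae ?_) (hmt.trans (lintegral_congr_ae ?_))
    · filter_upwards [hsp] with p hp
      refine tsum_congr fun i => ?_
      rw [(hr.isAccess _ hp).tsum_rsuShare_right hp hρ]
      split_ifs with h
      · rfl
      · rw [hr.maxMinRate_eq_zero hp hρ h]
    · filter_upwards [hsp] with p hp
      refine tsum_congr fun k => ?_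
      rw [(hr.isAccess _ hp).tsum_rsuShare_left hp hρ]
  · exact ((hR i).div (HighwayState.measurable_encard
      (HighwayState.measurableSet_mem_blockRSUs i)).aemeasurable).ite_zero
      (HighwayState.measurableSet_mem_blockRSUs i k)
  · filter_upwards [hsp] with p hp t
    obtain ⟨a, b, hab⟩ := p.isRelabel_shift hT0 t
    exact ⟨a, b, hab.rsuShare (hr.relabel hab) (hr.existsUnique hp hρ), hab.pos, hab.rsu⟩

/-- Sums over the capable vehicles per unit length can be collected at the cluster heads. -/
lemma windowSum_cap_eq_head (hS : IsHighway P lamV γ lamR S) {d : ℝ} (hd : 0 < d)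
    (hT : 2 * d < lamR⁻¹) {g : Snapshot → ℤ → ℝ≥0∞}
    (hg : ∀ i, AEMeasurable (fun p : HighwayState => g (p.toSnapshot lamR⁻¹) i)
      (P.map fun ω => (S ω).state))
    (hrel : ∀ {s s' : Snapshot} {a b : ℤ} {t : ℝ}, s.IsSparse d → s.IsRelabel s' a b t →
      ∀ i, g s' i = g s (i + a)) :
    windowSum P S (fun s i => s.cap i = true) g =
      windowSum P S (fun s i => s.IsClusterHead d i)
        (fun s j => ∑' i, (s.cluster d j).indicator (g s) i) := by
  classical
  have hT0 : 0 < lamR⁻¹ := by linarith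
  have hsp := hS.ae_map_isSparse hd hT
  have hind : ∀ j i, AEMeasurable (fun p : HighwayState =>
      ((p.toSnapshot lamR⁻¹).cluster d j).indicator (g (p.toSnapshot lamR⁻¹)) i)
      (P.map fun ω => (S ω).state) := by
    intro j i
    simp only [Set.indicator_apply]
    exact (hg i).ite_zero (HighwayState.measurableSet_reachable j i)
  rw [hS.windowSum_eq fun i => (hg i).ite_zero (HighwayState.measurableSet_cap i),
    hS.windowSum_eq fun j => (AEMeasurable.tsum (hind j)).ite_zero
      (HighwayState.measurableSet_isClusterHead j)]
  -- Each capable vehicle sends its whole value `g` to the unique head of its cluster.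
  let m : HighwayState → ℤ → ℤ → ℝ≥0∞ := fun p i j =>
    if (p.toSnapshot lamR⁻¹).IsClusterHead d j ∧
      ((p.toSnapshot lamR⁻¹).v2vGraph d).Reachable i j then g (p.toSnapshot lamR⁻¹) i else 0
  have hm : ∀ i j, AEMeasurable (fun p => m p i j) (P.map fun ω => (S ω).state) := by
    intro i j
    refine (hg i).ite_zero ?_
    exact (HighwayState.measurableSet_isClusterHead j).inter
      (HighwayState.measurableSet_reachable i j)
  have hmt := hS.mass_transport hT0 (m := m) (x := fun p => (p.toSnapshot lamR⁻¹).pos)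
    (y := fun p => (p.toSnapshot lamR⁻¹).pos)
    hm HighwayState.measurable_toSnapshot_pos HighwayState.measurable_toSnapshot_pos ?_
  · refine Eq.trans (lintegral_congr_ae ?_) (hmt.trans (lintegral_congr ?_))
    · filter_upwards [hsp] with p hp
      refine tsum_congr fun i => ?_
      congr 1
      split_ifs with h
      · rw [← mul_one (g _ i), ← hp.tsum_head hd h, ← ENNReal.tsum_mul_left]
        exact tsum_congr fun j => by rw [mul_ite, mul_one, mul_zero]
      · refine (ENNReal.tsum_eq_zero.2 fun j => if_neg ?_).symm
        exact fun hj => h (Snapshot.cap_of_reachable hj.2.symm hj.1.1)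
    · intro p
      refine tsum_congr fun j => ?_
      congr 1
      split_ifs with h
      · refine tsum_congr fun i => ?_
        simp only [m, h, true_and, Set.indicator_apply]
        exact if_congr ⟨fun h => h.symm, fun h => h.symm⟩ rfl rfl
      · exact ENNReal.tsum_eq_zero.2 fun i => if_neg fun hj => h hj.1
  · filter_upwards [hsp] with p hp t
    obtain ⟨a, b, hab⟩ := p.isRelabel_shift hT0 t
    refine ⟨a, a, fun i j => ?_, hab.pos, hab.pos⟩
    simp only [m, hrel hp hab i]
    exact if_congr (and_congr (hab.isClusterHead j) (hab.reachable i j)) rfl rfl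

end IsHighway

/-! ### The theorem -/

theorem theorem1 {Ω : Type*} [MeasurableSpace Ω] (P : Measure Ω) [IsProbabilityMeasure P]
    (lamV γ lamR d ρ : ℝ) (hlamV : 0 < lamV) (hγ : 0 < γ) (hγ1 : γ ≤ 1) (hlamR : 0 < lamR)
    (hd : 0 < d) (hdR : d < lamR⁻¹ / 2) (hρ : 0 < ρ)
    (S : Ω → Snapshot) (hS : IsHighway P lamV γ lamR S) :
    (∀ᵐ ω ∂P, (∃! R, IsMaxMinFair ((S ω).reachV2V d) (ENNReal.ofReal ρ) R) ∧
      ∃! R, IsMaxMinFair ((S ω).reachV2I d) (ENNReal.ofReal ρ) R) ∧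
    (∀ i, AEMeasurable (fun ω => maxMinRate ((S ω).reachV2V d) (ENNReal.ofReal ρ) i) P ∧
      AEMeasurable (fun ω => maxMinRate ((S ω).reachV2I d) (ENNReal.ofReal ρ) i) P) ∧
    meanRateV2V P S d ρ = meanRateV2I P S d ρ ∧
    meanRateV2V P S d ρ =
      ENNReal.ofReal (ρ / (γ * lamV * lamR⁻¹) * (1 - Real.exp (-2 * γ * lamV * d))) ∧
    0 < meanClusterSize P S d ∧ meanClusterSize P S d < ∞ ∧ meanClusterRSUs P S d < ∞ ∧
    meanRateV2V P S d ρ ≤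
      ENNReal.ofReal ρ * (meanClusterRSUs P S d / meanClusterSize P S d) := by
  have hT0 : 0 < lamR⁻¹ := inv_pos.2 hlamR
  have hT : 2 * d < lamR⁻¹ := by linarith
  have hρ' : ENNReal.ofReal ρ ≠ ∞ := ENNReal.ofReal_ne_top
  have hsp := hS.ae_isSparse hd hT
  have hspm := hS.ae_map_isSparse hd hT
  have hV := isAccessRule_reachV2V lamR⁻¹ hd
  have hI := isAccessRule_reachV2I lamR⁻¹ d
  have hmeas : ∀ {reach : Snapshot → ℤ → ℤ → Prop}, IsAccessRule lamR⁻¹ d reach → ∀ i,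
      AEMeasurable (fun ω => maxMinRate (reach (S ω)) (ENNReal.ofReal ρ) i) P := by
    intro reach hr i
    have := (hr.aemeasurable hT hspm hρ' i).comp_measurable hS.measurable_state
    simpa only [Function.comp_def, hS.toSnapshot_state] using this
  have hcap := hS.windowSum_cap_one
  have hcap0 : ENNReal.ofReal γ * ENNReal.ofReal lamV ≠ 0 := by simp [hγ, hlamV]
  have hcapT : ENNReal.ofReal γ * ENNReal.ofReal lamV ≠ ∞ := by finiteness
  have hrateV := hS.windowSum_rate hγ.le hγ1 hlamV.le hd hT hV hρ'
  have hrateI := hS.windowSum_rate hγ.le hγ1 hlamV.le hd hT hI hρ'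
  -- Transporting mass `1` from every capable vehicle to its head: cluster sizes summed over heads
  -- count the capable vehicles.
  have hsize : windowSum P S (fun s i => s.IsClusterHead d i) (fun s i => s.clusterSize d i) =
      ENNReal.ofReal γ * ENNReal.ofReal lamV := by
    rw [← hcap, hS.windowSum_cap_eq_head hd hT (g := fun _ _ => 1)
      (fun _ => aemeasurable_const) fun _ _ _ => rfl]
    congr 1
    ext s i
    rw [Snapshot.clusterSize, ← ENNReal.tsum_set_one, tsum_subtype (s.cluster d i) fun _ => 1]
  have hrate : windowSum P S (fun s i => s.cap i = true)
      (fun s i => maxMinRate (s.reachV2V d) (ENNReal.ofReal ρ) i) ≤ ENNReal.ofReal ρ *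
      windowSum P S (fun s i => s.IsClusterHead d i) (fun s i => s.clusterRSUs d i) := by
    rw [hS.windowSum_cap_eq_head hd hT (g := fun s i => maxMinRate (s.reachV2V d) _ i)
      (fun i => hV.aemeasurable hT hspm hρ' i)
      (fun hs h i => hV.maxMinRate_relabel h hs hρ' i), ← windowSum_const_mul hρ']
    refine windowSum_mono_ae ?_
    filter_upwards [hsp] with ω hω i _
    exact Snapshot.tsum_cluster_le
      (isMaxMinFair_maxMinRate (hV.existsUnique hω hρ').exists).1 i
  have hM : windowSum P S (fun s i => s.IsClusterHead d i) (fun s i => s.clusterRSUs d i) ≤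
      ENNReal.ofReal γ * ENNReal.ofReal lamV := by
    rw [← hsize]
    refine windowSum_mono_ae ?_
    filter_upwards [hsp] with ω hω i _ using hω.clusterRSUs_le i
  set H := windowSum P S (fun s i => s.IsClusterHead d i) (fun _ _ => 1) with hH
  have hHT : H ≠ ∞ := by
    refine ne_top_of_le_ne_top hcapT ?_
    rw [← hsize]
    refine windowSum_mono_ae (Filter.Eventually.of_forall fun ω i _ => ?_)
    have h : (1 : ℕ∞) ≤ ((S ω).cluster d i).encard :=
      Set.one_le_encard_iff_nonempty.2 ⟨i, SimpleGraph.Reachable.refl i⟩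
    simpa only [ENat.toENNReal_one, Snapshot.clusterSize] using ENat.toENNReal_mono h
  -- If almost surely no head lay in the window, the sum of cluster sizes over heads would vanish as
  -- well, whereas it equals `γ * lamV > 0`.
  have hH0 : H ≠ 0 := by
    classical
    intro h0
    have hm : ∀ i, Measurable fun p : HighwayState =>
        if (p.toSnapshot lamR⁻¹).IsClusterHead d i then (1 : ℝ≥0∞) else 0 := fun i =>
      Measurable.ite (HighwayState.measurableSet_isClusterHead i) measurable_const
        measurable_const
    have hm' : ∀ i, Measurable fun p : HighwayState =>
        if (p.toSnapshot lamR⁻¹).IsClusterHead d i then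
          (p.toSnapshot lamR⁻¹).clusterSize d i else 0 := fun i =>
      Measurable.ite (HighwayState.measurableSet_isClusterHead i)
        (HighwayState.measurable_encard (HighwayState.measurableSet_reachable i))
        measurable_const
    have hw : ∀ f : HighwayState → ℤ → ℝ≥0∞, (∀ i, Measurable fun p => f p i) →
        Measurable fun p => ∑' i, unitWindow 0 ((p.toSnapshot lamR⁻¹).pos i) * f p i :=
      fun f hf => Measurable.tsum fun i => ((measurable_unitWindow 0).comp
        (HighwayState.measurable_toSnapshot_pos i)).mul (hf i)
    rw [hH, hS.windowSum_eq fun i => (hm i).aemeasurable, lintegral_eq_zero_iff (hw _ hm)] at h0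
    refine hcap0 ?_
    rw [← hsize, hS.windowSum_eq fun i => (hm' i).aemeasurable, lintegral_eq_zero_iff (hw _ hm')]
    filter_upwards [h0] with p hp
    simp only [Pi.zero_apply, ENNReal.tsum_eq_zero, mul_eq_zero, ite_eq_right_iff, one_ne_zero,
      imp_false] at hp ⊢
    exact fun i => (hp i).imp_right fun h h' => absurd h' h
  refine ⟨?_, fun i => ⟨hmeas hV i, hmeas hI i⟩, ?_, ?_, ?_, ?_, ?_, ?_⟩
  · filter_upwards [hsp] with ω hω
    exact ⟨hV.existsUnique hω hρ', hI.existsUnique hω hρ'⟩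
  · rw [meanRateV2V, meanRateV2I, palmMean, palmMean, hrateV, hrateI]
  · rw [meanRateV2V, palmMean, hrateV, hcap, ← ENNReal.ofReal_mul hγ.le,
      ← ENNReal.ofReal_inv_of_pos hT0, ← ENNReal.ofReal_mul hρ.le,
      ← ENNReal.ofReal_mul' (by positivity), ← ENNReal.ofReal_div_of_pos (by positivity)]
    congr 1
    field_simp
  · rw [meanClusterSize, palmMean, hsize]
    exact ENNReal.div_pos hcap0 hHT
  · rw [meanClusterSize, palmMean, hsize]
    exact ENNReal.div_lt_top hcapT hH0
  · rw [meanClusterRSUs, palmMean]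
    exact ENNReal.div_lt_top (ne_top_of_le_ne_top hcapT hM) hH0
  -- The density `H` of heads divides both Palm means and cancels, as it is neither `0` nor
  -- infinite; the remaining denominator is the density of capable vehicles on both sides.
  · rw [meanRateV2V, meanClusterRSUs, meanClusterSize, palmMean, palmMean, palmMean, hsize, hcap,
      ← hH, div_eq_mul_inv _ H, div_eq_mul_inv _ H, ENNReal.mul_div_mul_right _ _
      (ENNReal.inv_ne_zero.2 hHT) (ENNReal.inv_ne_top.2 hH0), ← mul_div_assoc]
    exact ENNReal.div_le_div_right hrate _
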